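/- Let $p>2$ and $a=p-1$. Let $\nu(dx)=a x^{a-1}dx$ and $\pi(dx)=(a+1)x^{a}dx$ on $[0,1]$, and let $F_\pi^{-1}$ be the inverse of the cumulative distribution function of $\pi$. On a probability space, let $W_0$ have law $\nu$ and let $(U_k,V_k)_{k\ge 1}$ be independent random vectors, uniformly distributed on $[0,1]^2$ and independent of $W_0$. For $k\ge1$ put $$W_k = W_{k-1}\mathbf 1_{\{U_k\ge W_{k-1}\}} + F_\pi^{-1}(V_k)\,\mathbf 1_{\{U_k< W_{k-1}\}}.$$ (i) Let $W_0^*$ have law $\nu$ and be independent of $(W_0,(U_k,V_k)_{k\ge1})$, let $(W_k^*)_{k\ge 0}$ be defined from $W_0^*$ by the same recursion with the same $(U_k,V_k)$, and let $T^*=\inf\{k\ge 0: W_k=W_k^*\}$ (with $\inf\emptyset=\infty$). Then the condition $\sum_{n\ge1}n^{p-2}\,\mathbb P(T^*\ge n)<\infty$ fails. (ii) For every function $f:[0,1]\to\mathbb R$ with continuous and strictly positive derivative on $[0,1]$, and every centered stationary Gaussian sequence $(g_k)_{k\in\mathbb Z}$ defined on the same probability space (with arbitrary dependence on the chain) whose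 series of covariances $\sum_{k\ge0}\mathrm{Cov}(g_0,g_k)$ converges, $$\limsup_{n\to\infty}\,(n\log n)^{-1/p}\,\Big|\sum_{k=1}^n f(W_k^{a})-n\int_0^1 f(t)\,dt-\sum_{k=1}^n g_k\Big|>0\quad\text{almost surely},$$ where $W_k^a$ denotes the $a$-th power of $W_k$ and the limsup takes values in $[0,\infty]$. -/

import Mathlib

open MeasureTheory ProbabilityTheory Filter Set Topology
open scoped ENNReal

noncomputable section

/-- The law `π(dx) = (a+1) x^a dx` on `[0,1]`. -/
def piLaw (a : ℝ) : Measure ℝ :=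
  (volume.restrict (Icc (0 : ℝ) 1)).withDensity fun x => ENNReal.ofReal ((a + 1) * x ^ a)

/-- The law `ν(dx) = a x^(a-1) dx` on `[0,1]`. -/
def nuLaw (a : ℝ) : Measure ℝ :=
  (volume.restrict (Icc (0 : ℝ) 1)).withDensity fun x => ENNReal.ofReal (a * x ^ (a - 1))

/-- The uniform law on the unit square `[0,1]²`. -/
def uniformSquare : Measure (ℝ × ℝ) :=
  volume.restrict (Icc (0 : ℝ) 1 ×ˢ Icc (0 : ℝ) 1)

/-- The inverse `F_π⁻¹` on `[0,1]` of the cumulative distribution function of `π`. -/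
def piQuantile (a v : ℝ) : ℝ :=
  sInf {x : ℝ | x ∈ Icc (0 : ℝ) 1 ∧ v ≤ cdf (piLaw a) x}

/-- One step of the chain, driven by `e = (U, V)`: from `w`, stay at `w` if `U ≥ w`, and jump to
`F_π⁻¹(V)` if `U < w`. -/
def chainStep (a : ℝ) (e : ℝ × ℝ) (w : ℝ) : ℝ :=
  if w ≤ e.1 then w else piQuantile a e.2

/-- The chain `W_0 = ξ`, `W_{k+1} = chainStep (ε_{k+1}, W_k)`. The innovations `ε_1, ε_2, …` are
indexed here from `0`: the innovation used in the step from `W_k` to `W_{k+1}` is `ε k`. -/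
def chain {Ω : Type*} (a : ℝ) (ξ : Ω → ℝ) (ε : ℕ → Ω → ℝ × ℝ) : ℕ → Ω → ℝ
  | 0, ω => ξ ω
  | k + 1, ω => chainStep a (ε k ω) (chain a ξ ε k ω)

/-- The meeting time `inf {k ≥ 0 : W_k = W'_k}`, equal to `⊤` if the paths never meet. -/
def meetingTime {Ω : Type*} (W W' : ℕ → Ω → ℝ) (ω : Ω) : ℕ∞ :=
  ⨅ (k : ℕ) (_ : W k ω = W' k ω), (k : ℕ∞)

/-- The condition `∑_{n ≥ 1} n^(p-2) P(T ≥ n) < ∞` on a random time `T`. -/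
def TailSumFinite {Ω : Type*} [MeasurableSpace Ω] (P : Measure Ω) (p : ℝ) (T : Ω → ℕ∞) : Prop :=
  ∑' n : ℕ, ENNReal.ofReal (((n + 1 : ℕ) : ℝ) ^ (p - 2)) * P {ω | ((n + 1 : ℕ) : ℕ∞) ≤ T ω} < ∞

/-- The initial variable `ξ` has law `ν`, the innovations are iid uniform on the unit square, and
`ξ` is independent of the sequence of innovations. -/
structure IsChainInput {Ω : Type*} [MeasurableSpace Ω] (P : Measure Ω) (a : ℝ)
    (ξ : Ω → ℝ) (ε : ℕ → Ω → ℝ × ℝ) : Prop where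
  measurable_init : Measurable ξ
  measurable_innov : ∀ k, Measurable (ε k)
  law_init : P.map ξ = nuLaw a
  law_innov : ∀ k, P.map (ε k) = uniformSquare
  indep_innov : iIndepFun ε P
  indep_init : IndepFun ξ (fun ω k => ε k ω) P

/-- `(g_k)_{k ∈ ℤ}` is a centered stationary Gaussian sequence whose series of covariances
`∑_{k ≥ 0} Cov(g_0, g_k)` converges (not necessarily absolutely). -/
structure IsStationaryGaussian {Ω : Type*} [MeasurableSpace Ω] (P : Measure Ω)
    (g : ℤ → Ω → ℝ) : Prop where
  gaussian : IsGaussianProcess g P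
  centered : ∀ k, ∫ ω, g k ω ∂P = 0
  stationary : ∀ m : ℤ, IdentDistrib (fun ω k => g (k + m) ω) (fun ω k => g k ω) P P
  cov_series : ∃ s : ℝ, Tendsto
    (fun n : ℕ => ∑ k ∈ Finset.range n, cov[g 0, g (k : ℤ); P]) atTop (𝓝 s)

end

/-!
From a point `w` the chain leaves with probability `w`, and then it moves to a point of law `π`.
Near `0` it therefore stays for a time of order `1 / w`, and since `π([0, x]) = x ^ p`, holding
times have tails of order `n ^ (-p)`. Both claims come from these long stays.

For the meeting time: if `W_0 ≤ 1 / (2 n)`, which has probability of order `n ^ (1 - p)`, the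
chain stays at `W_0` up to time `n` with probability at least `1 / 2`, and the second chain almost
surely never visits the point `W_0` (`ae_forall_chain_ne_init`). So `n ^ (p - 2) P(T ≥ n)` is at
least of order `1 / n`.

For the Gaussian approximation, write `b n = (n log n) ^ (1 / p)`. A jump to a point below `1 / b
n` at time `n` has conditional probability `W_n / (n log n)`, and `∑ 1 / (n log n) = ∞`. That such
jumps occur infinitely often (`ae_exists_low_jump`) is a second moment argument for the martingale
built from the truncation of `1 / w`, whose drift turns the random intensity `W_n` into a
constant; stationarity controls the truncation. Decomposing over the first such jump after a given
time, and using that it is independent of the later innovations, one finds that some such jump is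
followed by a stay of length `c b n` with probability at least `1 - c`
(`measure_no_long_hold_le`). As `c → 0`, almost surely there is a `c` for which this happens
infinitely often (`ae_exists_frequently_hold`).

During such a stay `f (W ^ a)` is close to `f 0 < ∫ f`, so the centered sum decreases by a
multiple of `b n`. A Gaussian block sum of length `L ≥ c b n` has variance `O(L)`, because the
covariance series has bounded partial sums, so it exceeds `δ L` with probability at most `2 exp (-
const * L)`. This is summable in `n`, and Borel–Cantelli bounds the block sums for any dependence
between the sequence and the chain (`IsStationaryGaussian.ae_eventually_abs_block_le`). Hence the
error changes by a multiple of `b n` over infinitely many blocks on which `b` itself varies by a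
bounded factor (`zero_lt_limsup_of_frequently_block`).
-/

/-! ### The laws, the quantile function and invariance -/

theorem piLaw_eq_nuLaw (a : ℝ) : piLaw a = nuLaw (a + 1) := by
  simp [piLaw, nuLaw]

theorem lintegral_Icc_mul_rpow {a x : ℝ} (ha : 0 < a) (hx : 0 ≤ x) :
    ∫⁻ t in Icc (0 : ℝ) x, ENNReal.ofReal (a * t ^ (a - 1)) = ENNReal.ofReal (x ^ a) := by
  have hint : IntervalIntegrable (fun t : ℝ => a * t ^ (a - 1)) volume 0 x :=
    (intervalIntegral.intervalIntegrable_rpow' (by linarith)).const_mul a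
  rw [← ofReal_integral_eq_lintegral_ofReal]
  · rw [integral_Icc_eq_integral_Ioc, ← intervalIntegral.integral_of_le hx,
      intervalIntegral.integral_const_mul, integral_rpow (Or.inl (by linarith)),
      sub_add_cancel, Real.zero_rpow ha.ne', sub_zero, mul_div_cancel₀ _ ha.ne']
  · exact (intervalIntegrable_iff_integrableOn_Icc_of_le hx).1 hint
  · refine (ae_restrict_iff' measurableSet_Icc).2 (ae_of_all _ fun t ht => ?_)
    exact mul_nonneg ha.le (Real.rpow_nonneg ht.1 _)

theorem nuLaw_apply (a : ℝ) {s : Set ℝ} (hs : MeasurableSet s) :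
    nuLaw a s = ∫⁻ t in s ∩ Icc 0 1, ENNReal.ofReal (a * t ^ (a - 1)) := by
  rw [nuLaw, withDensity_apply _ hs, Measure.restrict_restrict hs]

theorem nuLaw_Iic {a x : ℝ} (ha : 0 < a) (hx : x ∈ Icc (0 : ℝ) 1) :
    nuLaw a (Iic x) = ENNReal.ofReal (x ^ a) := by
  rw [nuLaw_apply a measurableSet_Iic, ← lintegral_Icc_mul_rpow ha hx.1]
  congr 2
  ext t
  simp only [mem_inter_iff, mem_Iic, mem_Icc]
  exact ⟨fun h => ⟨h.2.1, h.1⟩, fun h => ⟨h.2, h.1, h.2.trans hx.2⟩⟩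

theorem isProbabilityMeasure_nuLaw {a : ℝ} (ha : 0 < a) : IsProbabilityMeasure (nuLaw a) := by
  constructor
  rw [nuLaw_apply a MeasurableSet.univ, univ_inter, lintegral_Icc_mul_rpow ha zero_le_one]
  simp

theorem ae_mem_Icc_nuLaw (a : ℝ) : ∀ᵐ x ∂(nuLaw a), x ∈ Icc (0 : ℝ) 1 :=
  (withDensity_absolutelyContinuous _ _).ae_le (ae_restrict_mem measurableSet_Icc)

theorem nuLaw_singleton (a x : ℝ) : nuLaw a {x} = 0 := by
  refine (withDensity_absolutelyContinuous _ _) ?_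
  exact measure_singleton x

theorem cdf_piLaw {a x : ℝ} (ha : 0 < a) (hx : x ∈ Icc (0 : ℝ) 1) :
    cdf (piLaw a) x = x ^ (a + 1) := by
  have ha' : 0 < a + 1 := by linarith
  have := isProbabilityMeasure_nuLaw ha'
  rw [piLaw_eq_nuLaw, cdf_eq_real, measureReal_def, nuLaw_Iic ha' hx,
    ENNReal.toReal_ofReal (Real.rpow_nonneg hx.1 _)]

/-- The quantile function in closed form, junk values outside `[0,1]` included. -/
theorem piQuantile_eq {a : ℝ} (ha : 0 < a) (v : ℝ) :
    piQuantile a v = if v ∈ Icc (0 : ℝ) 1 then v ^ (a + 1)⁻¹ else 0 := by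
  have ha' : 0 < a + 1 := by linarith
  unfold piQuantile
  split_ifs with hv
  · have hq : v ^ (a + 1)⁻¹ ∈ Icc (0 : ℝ) 1 :=
      ⟨Real.rpow_nonneg hv.1 _, Real.rpow_le_one hv.1 hv.2 (by positivity)⟩
    have hset : {x : ℝ | x ∈ Icc (0 : ℝ) 1 ∧ v ≤ cdf (piLaw a) x} = Icc (v ^ (a + 1)⁻¹) 1 := by
      ext x
      constructor
      · rintro ⟨hx, hvx⟩
        rw [cdf_piLaw ha hx] at hvx
        exact ⟨(Real.rpow_inv_le_iff_of_pos hv.1 hx.1 ha').2 hvx, hx.2⟩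
      · rintro ⟨hx1, hx2⟩
        have hx : x ∈ Icc (0 : ℝ) 1 := ⟨hq.1.trans hx1, hx2⟩
        refine ⟨hx, ?_⟩
        rw [cdf_piLaw ha hx]
        exact (Real.rpow_inv_le_iff_of_pos hv.1 hx.1 ha').1 hx1
    rw [hset, csInf_Icc hq.2]
  · rcases lt_or_ge v 0 with h0 | h0
    · have hset : {x : ℝ | x ∈ Icc (0 : ℝ) 1 ∧ v ≤ cdf (piLaw a) x} = Icc 0 1 := by
        ext x
        simp only [mem_ofPred_eq, and_iff_left_iff_imp]
        exact fun _ => h0.le.trans (cdf_nonneg _ _)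
      rw [hset, csInf_Icc zero_le_one]
    · have h1 : 1 < v := by
        by_contra h
        exact hv ⟨h0, not_lt.1 h⟩
      have hset : {x : ℝ | x ∈ Icc (0 : ℝ) 1 ∧ v ≤ cdf (piLaw a) x} = ∅ := by
        ext x
        simp only [mem_ofPred_eq, mem_empty_iff_false, iff_false, not_and, not_le]
        exact fun _ => (cdf_le_one _ _).trans_lt h1
      rw [hset, Real.sInf_empty]

theorem piQuantile_of_mem {a v : ℝ} (ha : 0 < a) (hv : v ∈ Icc (0 : ℝ) 1) :
    piQuantile a v = v ^ (a + 1)⁻¹ := by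
  rw [piQuantile_eq ha, if_pos hv]

theorem piQuantile_mem {a : ℝ} (ha : 0 < a) (v : ℝ) : piQuantile a v ∈ Icc (0 : ℝ) 1 := by
  rw [piQuantile_eq ha]
  split_ifs with hv
  · exact ⟨Real.rpow_nonneg hv.1 _, Real.rpow_le_one hv.1 hv.2 (by positivity)⟩
  · simp

theorem measurable_piQuantile {a : ℝ} (ha : 0 < a) : Measurable (piQuantile a) := by
  rw [funext (piQuantile_eq ha)]
  exact Measurable.ite measurableSet_Icc (by fun_prop) measurable_const

theorem measurable_chainStep {a : ℝ} (ha : 0 < a) :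
    Measurable fun q : ℝ × (ℝ × ℝ) => chainStep a q.2 q.1 := by
  unfold chainStep
  refine Measurable.ite (measurableSet_le ?_ ?_) ?_ ?_
  · fun_prop
  · fun_prop
  · fun_prop
  · exact (measurable_piQuantile ha).comp (by fun_prop)

instance isProbabilityMeasure_unitUniform :
    IsProbabilityMeasure (volume.restrict (Icc (0 : ℝ) 1)) := ⟨by simp⟩

theorem uniformSquare_eq_prod :
    uniformSquare = (volume.restrict (Icc (0 : ℝ) 1)).prod (volume.restrict (Icc (0 : ℝ) 1)) := by
  rw [uniformSquare, Measure.prod_restrict, Measure.volume_eq_prod]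

instance isProbabilityMeasure_uniformSquare : IsProbabilityMeasure uniformSquare := by
  rw [uniformSquare_eq_prod]; infer_instance

theorem unitUniform_Iic {x : ℝ} (hx : x ∈ Icc (0 : ℝ) 1) :
    volume.restrict (Icc (0 : ℝ) 1) (Iic x) = ENNReal.ofReal x := by
  rw [Measure.restrict_apply measurableSet_Iic]
  have : Iic x ∩ Icc 0 1 = Icc 0 x := by
    ext t
    simp only [mem_inter_iff, mem_Iic, mem_Icc]
    exact ⟨fun h => ⟨h.2.1, h.1⟩, fun h => ⟨h.2, h.1, h.2.trans hx.2⟩⟩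
  rw [this, Real.volume_Icc, sub_zero]

theorem unitUniform_Iio {x : ℝ} (hx : x ∈ Icc (0 : ℝ) 1) :
    volume.restrict (Icc (0 : ℝ) 1) (Iio x) = ENNReal.ofReal x := by
  rw [← unitUniform_Iic hx]
  exact measure_congr Iio_ae_eq_Iic

theorem unitUniform_Ici {x : ℝ} (hx : x ∈ Icc (0 : ℝ) 1) :
    volume.restrict (Icc (0 : ℝ) 1) (Ici x) = ENNReal.ofReal (1 - x) := by
  rw [← compl_Iio, prob_compl_eq_one_sub measurableSet_Iio, unitUniform_Iio hx,
    ENNReal.ofReal_sub _ hx.1, ENNReal.ofReal_one]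

theorem map_piQuantile {a : ℝ} (ha : 0 < a) :
    (volume.restrict (Icc (0 : ℝ) 1)).map (piQuantile a) = piLaw a := by
  have ha' : 0 < a + 1 := by linarith
  have hq := measurable_piQuantile ha
  have := isProbabilityMeasure_nuLaw ha'
  have : IsProbabilityMeasure ((volume.restrict (Icc (0 : ℝ) 1)).map (piQuantile a)) :=
    Measure.isProbabilityMeasure_map hq.aemeasurable
  rw [piLaw_eq_nuLaw]
  refine Measure.ext_of_Iic _ _ fun x => ?_
  rw [Measure.map_apply hq measurableSet_Iic]
  by_cases hx : x ∈ Icc (0 : ℝ) 1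
  · have hx' : x ^ (a + 1) ∈ Icc (0 : ℝ) 1 :=
      ⟨Real.rpow_nonneg hx.1 _, Real.rpow_le_one hx.1 hx.2 ha'.le⟩
    rw [nuLaw_Iic ha' hx, ← unitUniform_Iic hx']
    refine measure_congr ?_
    filter_upwards [ae_restrict_mem measurableSet_Icc] with v hv
    refine propext ?_
    change piQuantile a v ≤ x ↔ v ≤ x ^ (a + 1)
    rw [piQuantile_of_mem ha hv, Real.rpow_inv_le_iff_of_pos hv.1 hx.1 ha']
  · rcases lt_or_ge x 0 with h0 | h0
    · have h1 : piQuantile a ⁻¹' Iic x = ∅ := by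
        ext v
        simp only [mem_preimage, mem_Iic, mem_empty_iff_false, iff_false, not_le]
        exact h0.trans_le (piQuantile_mem ha v).1
      have h2 : nuLaw (a + 1) (Iic x) = 0 := by
        have : Iic x ∩ Icc (0 : ℝ) 1 = ∅ := by
          ext y
          simp only [mem_inter_iff, mem_Iic, mem_Icc, mem_empty_iff_false, iff_false]
          exact fun hy => absurd (hy.2.1.trans hy.1) (not_le.2 h0)
        rw [nuLaw_apply _ measurableSet_Iic, this]
        simp
      rw [h1, h2, measure_empty]
    · have hx1 : 1 < x := by
        by_contra h
        exact hx ⟨h0, not_lt.1 h⟩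
      have h1 : piQuantile a ⁻¹' Iic x = univ := by
        ext v
        simp only [mem_preimage, mem_Iic, mem_univ, iff_true]
        exact (piQuantile_mem ha v).2.trans hx1.le
      have h2 : nuLaw (a + 1) (Iic x) = 1 := by
        rw [← (isProbabilityMeasure_nuLaw ha').measure_univ, nuLaw_apply _ measurableSet_Iic,
          nuLaw_apply _ MeasurableSet.univ, univ_inter,
          inter_eq_right.2 fun y hy => hy.2.trans hx1.le]
      rw [h1, h2, measure_univ]

/-- The transition kernel of the chain: `w ↦ (1 - w) δ_w + w π`. -/
theorem uniformSquare_chainStep {a w : ℝ} (ha : 0 < a) (hw : w ∈ Icc (0 : ℝ) 1) {s : Set ℝ}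
    (hs : MeasurableSet s) :
    uniformSquare {e | chainStep a e w ∈ s} =
      ENNReal.ofReal (1 - w) * s.indicator 1 w + ENNReal.ofReal w * piLaw a s := by
  have hq := measurable_piQuantile ha
  have hset : {e : ℝ × ℝ | chainStep a e w ∈ s} =
      (Ici w ×ˢ {_v : ℝ | w ∈ s}) ∪ (Iio w ×ˢ (piQuantile a ⁻¹' s)) := by
    ext e
    simp only [chainStep, mem_ofPred_eq, mem_union, mem_prod, mem_Ici, mem_Iio, mem_preimage]
    by_cases h : w ≤ e.1
    · simp [h]
    · simp [h, not_le.1 h]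
  have hdisj : Disjoint (Ici w ×ˢ {_v : ℝ | w ∈ s}) (Iio w ×ˢ (piQuantile a ⁻¹' s)) := by
    rw [Set.disjoint_left]
    rintro e ⟨h1, -⟩ ⟨h2, -⟩
    exact absurd (mem_Ici.1 h1) (not_le.2 h2)
  rw [hset, measure_union hdisj (measurableSet_Iio.prod (hq hs)), uniformSquare_eq_prod,
    Measure.prod_prod, Measure.prod_prod, unitUniform_Ici hw, unitUniform_Iio hw,
    ← Measure.map_apply hq hs, map_piQuantile ha]
  congr 2
  by_cases h : w ∈ s <;> simp [h]

/-- `ν` is invariant for the chain. -/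
theorem map_chainStep_nuLaw {a : ℝ} (ha : 0 < a) :
    ((nuLaw a).prod uniformSquare).map (fun q : ℝ × (ℝ × ℝ) => chainStep a q.2 q.1) = nuLaw a := by
  have ha' : 0 < a + 1 := by linarith
  have := isProbabilityMeasure_nuLaw ha
  have hm := measurable_chainStep ha
  have hd : Measurable fun t : ℝ => ENNReal.ofReal (a * t ^ (a - 1)) := by fun_prop
  ext s hs
  rw [Measure.map_apply hm hs, Measure.prod_apply (hm hs)]
  have h1 : ∫⁻ w, uniformSquare (Prod.mk w ⁻¹' ((fun q : ℝ × (ℝ × ℝ) => chainStep a q.2 q.1) ⁻¹' s))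
      ∂(nuLaw a) = ∫⁻ w, (ENNReal.ofReal (1 - w) * s.indicator 1 w
        + ENNReal.ofReal w * piLaw a s) ∂(nuLaw a) := by
    refine lintegral_congr_ae ?_
    filter_upwards [ae_mem_Icc_nuLaw a] with w hw
    exact uniformSquare_chainStep ha hw hs
  have hmg : Measurable fun w : ℝ => ENNReal.ofReal (1 - w) * s.indicator 1 w
        + ENNReal.ofReal w * piLaw a s := by
    refine Measurable.add (Measurable.mul (by fun_prop) ?_) (by fun_prop)
    exact measurable_one.indicator hs
  have hpow : ∀ w ∈ Icc (0 : ℝ) 1, 0 ≤ a * w ^ (a - 1) := fun w hw =>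
    mul_nonneg ha.le (Real.rpow_nonneg hw.1 _)
  have hmul : ∀ w ∈ Icc (0 : ℝ) 1, w * (a * w ^ (a - 1)) = a * w ^ a := by
    intro w hw
    rcases hw.1.eq_or_lt with h | h
    · rw [← h, Real.zero_rpow ha.ne']; simp
    · rw [Real.rpow_sub_one h.ne']; field_simp
  -- the jump part: `π` has density proportional to `w` with respect to `ν`
  have h2 : (∫⁻ w in Icc (0 : ℝ) 1, ENNReal.ofReal (a * w ^ a)) * piLaw a s
      = ∫⁻ w in Icc (0 : ℝ) 1, s.indicator (fun w => ENNReal.ofReal (a * w ^ a)) w := by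
    have e1 : ∀ w : ℝ, ENNReal.ofReal (a * w ^ a)
        = ENNReal.ofReal (a / (a + 1)) * ENNReal.ofReal ((a + 1) * w ^ (a + 1 - 1)) := by
      intro w
      rw [← ENNReal.ofReal_mul (by positivity), add_sub_cancel_right]
      congr 1; field_simp
    have hm1 : Measurable fun w : ℝ => ENNReal.ofReal ((a + 1) * w ^ (a + 1 - 1)) := by fun_prop
    rw [lintegral_indicator hs, Measure.restrict_restrict hs]
    simp_rw [e1]
    rw [lintegral_const_mul _ hm1, lintegral_const_mul _ hm1,
        lintegral_Icc_mul_rpow ha' zero_le_one,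
      piLaw_eq_nuLaw, nuLaw_apply _ hs]
    simp
  rw [h1, nuLaw, lintegral_withDensity_eq_lintegral_mul _ hd hmg, ← nuLaw]
  calc _ = ∫⁻ w in Icc (0 : ℝ) 1, (s.indicator (fun w => ENNReal.ofReal
      ((1 - w) * (a * w ^ (a - 1)))) w
        + ENNReal.ofReal (a * w ^ a) * piLaw a s) := by
        refine setLIntegral_congr_fun measurableSet_Icc fun w hw => ?_
        simp only [Pi.mul_apply, mul_add]
        congr 1
        · by_cases h : w ∈ s
          · simp only [h, indicator_of_mem, Pi.one_apply, mul_one]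
            rw [mul_comm, ← ENNReal.ofReal_mul (by linarith [hw.2])]
          · simp [h]
        · rw [← mul_assoc, mul_comm (ENNReal.ofReal _) (ENNReal.ofReal w),
            ← ENNReal.ofReal_mul hw.1, hmul w hw]
    _ = (∫⁻ w in Icc (0 : ℝ) 1, s.indicator (fun w => ENNReal.ofReal
        ((1 - w) * (a * w ^ (a - 1)))) w)
        + ∫⁻ w in Icc (0 : ℝ) 1, s.indicator (fun w => ENNReal.ofReal (a * w ^ a)) w := by
        rw [lintegral_add_right _ (by fun_prop), lintegral_mul_const _ (by fun_prop), h2]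
    _ = ∫⁻ w in Icc (0 : ℝ) 1, s.indicator (fun w => ENNReal.ofReal (a * w ^ (a - 1))) w := by
        rw [← lintegral_add_right _ (Measurable.indicator (by fun_prop) hs)]
        refine setLIntegral_congr_fun measurableSet_Icc fun w hw => ?_
        by_cases h : w ∈ s
        · simp only [h, indicator_of_mem]
          rw [← hmul w hw, ← ENNReal.ofReal_add]
          · congr 1; ring
          · exact mul_nonneg (by linarith [hw.2]) (hpow w hw)
          · exact mul_nonneg hw.1 (hpow w hw)
        · simp [h]
    _ = nuLaw a s := by
        rw [lintegral_indicator hs, Measure.restrict_restrict hs, nuLaw_apply a hs]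

/-! ### Independence of the past and stationarity -/

section Independence

variable {Ω : Type*} [MeasurableSpace Ω] {P : Measure Ω}

theorem indepFun_prodMk_of_indepFun_prodMk {α β γ : Type*} [MeasurableSpace α] [MeasurableSpace β]
    [MeasurableSpace γ] [IsProbabilityMeasure P] {X : Ω → α} {Y : Ω → β} {Z : Ω → γ}
    (hX : Measurable X) (hY : Measurable Y) (hZ : Measurable Z)
    (h1 : IndepFun X (fun ω => (Y ω, Z ω)) P) (h2 : IndepFun Y Z P) :
    IndepFun (fun ω => (X ω, Y ω)) Z P := by
  have hXY : IndepFun X Y P := h1.comp measurable_id measurable_fst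
  have := Measure.isProbabilityMeasure_map (μ := P) hX.aemeasurable
  have := Measure.isProbabilityMeasure_map (μ := P) hY.aemeasurable
  have := Measure.isProbabilityMeasure_map (μ := P) hZ.aemeasurable
  rw [indepFun_iff_map_prod_eq_prod_map_map (by fun_prop) (by fun_prop)] at h1 h2 hXY ⊢
  rw [hXY, ← MeasurableEquiv.prodAssoc.map_measurableEquiv_injective.eq_iff, Measure.prodAssoc_prod,
    ← h2, ← h1, Measure.map_map MeasurableEquiv.prodAssoc.measurable (by fun_prop)]
  rfl

theorem ae_ne_of_indepFun_of_singleton_null [IsProbabilityMeasure P] {X Y : Ω → ℝ}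
    (hX : Measurable X) (hY : Measurable Y) (h : IndepFun X Y P)
    (h0 : ∀ x, P.map X {x} = 0) : ∀ᵐ ω ∂P, X ω ≠ Y ω := by
  have := Measure.isProbabilityMeasure_map (μ := P) hX.aemeasurable
  have := Measure.isProbabilityMeasure_map (μ := P) hY.aemeasurable
  have hD : MeasurableSet {q : ℝ × ℝ | q.1 = q.2} := measurableSet_eq_fun (by fun_prop)
      (by fun_prop)
  have hmap := h.symm.map_prod_eq_prod_map_map hY.aemeasurable hX.aemeasurable
  have h1 : P.map (fun ω => (Y ω, X ω)) {q : ℝ × ℝ | q.1 = q.2} = 0 := by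
    rw [hmap, Measure.prod_apply hD]
    refine (lintegral_congr fun y => ?_).trans lintegral_zero
    convert h0 y using 2
    ext x
    simp [eq_comm]
  rw [Measure.map_apply (by fun_prop) hD] at h1
  refine measure_mono_null (fun ω hω => ?_) h1
  simpa [eq_comm] using hω

end Independence

/-- The σ-algebra generated by the initial variable and the first `n` innovations. -/
abbrev chainPast {Ω : Type*} (ξ : Ω → ℝ) (ε : ℕ → Ω → ℝ × ℝ) (n : ℕ) : MeasurableSpace Ω :=
  MeasurableSpace.comap (fun ω => (ξ ω, fun i : Finset.range n => ε i ω)) inferInstance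

section Chain

variable {Ω : Type*} {ξ : Ω → ℝ} {ε : ℕ → Ω → ℝ × ℝ} {a : ℝ}

theorem measurable_init_chainPast (n : ℕ) : Measurable[chainPast ξ ε n] ξ :=
  measurable_fst.comp (comap_measurable (fun ω => (ξ ω, fun i : Finset.range n => ε i ω)))

theorem measurable_innov_chainPast {i n : ℕ} (hi : i < n) : Measurable[chainPast ξ ε n] (ε i) :=
  ((measurable_pi_apply (⟨i, Finset.mem_range.2 hi⟩ : Finset.range n)).comp measurable_snd).comp
    (comap_measurable (fun ω => (ξ ω, fun i : Finset.range n => ε i ω)))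

theorem measurable_chain_chainPast (ha : 0 < a) {k n : ℕ} (hk : k ≤ n) :
    Measurable[chainPast ξ ε n] (chain a ξ ε k) := by
  induction k with
  | zero => exact measurable_init_chainPast n
  | succ k ih =>
    exact (measurable_chainStep ha).comp
      ((ih (by omega)).prodMk (measurable_innov_chainPast (by omega)))

variable [MeasurableSpace Ω] {P : Measure Ω}

theorem chainPast_le (h : IsChainInput P a ξ ε) (n : ℕ) :
    chainPast ξ ε n ≤ ‹MeasurableSpace Ω› := by
  refine Measurable.comap_le ?_
  exact h.measurable_init.prodMk (measurable_pi_iff.2 fun i => h.measurable_innov i)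

theorem measurable_chain (ha : 0 < a) (h : IsChainInput P a ξ ε) (k : ℕ) :
    Measurable (chain a ξ ε k) :=
  (measurable_chain_chainPast ha le_rfl).mono (chainPast_le h k) le_rfl

variable [IsProbabilityMeasure P]

theorem indep_chainPast (h : IsChainInput P a ξ ε) {n : ℕ} {T : Finset ℕ} (hT : ∀ j ∈ T, n ≤ j) :
    Indep (chainPast ξ ε n)
      (MeasurableSpace.comap (fun ω (j : T) => ε j ω) inferInstance) P := by
  have hm := h.measurable_innov
  have hS : ∀ S : Finset ℕ, Measurable fun ω (i : S) => ε i ω := fun S =>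
    measurable_pi_iff.2 fun i => hm i
  refine indepFun_prodMk_of_indepFun_prodMk (Z := fun ω (j : T) => ε j ω) h.measurable_init
    (hS _) (hS T) ?_ ?_
  · have hφ : Measurable fun x : ℕ → ℝ × ℝ =>
        ((fun i : Finset.range n => x i), (fun j : T => x j)) := by fun_prop
    exact h.indep_init.comp measurable_id hφ
  · refine iIndepFun.indepFun_finset _ _ ?_ h.indep_innov hm
    rw [Finset.disjoint_left]
    intro i hi hiT
    have := hT i hiT
    have := Finset.mem_range.1 hi
    omega

theorem indepFun_innov_of_chainPast (h : IsChainInput P a ξ ε) {β : Type*} [MeasurableSpace β]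
    {n : ℕ} {X : Ω → β} (hX : Measurable[chainPast ξ ε n] X) : IndepFun X (ε n) P := by
  refine indep_of_indep_of_le_left (indep_of_indep_of_le_right
    (indep_chainPast h (n := n) (T := {n}) (by simp)) ?_) hX.comap_le
  have : ε n = (fun x : ({n} : Finset ℕ) → ℝ × ℝ => x ⟨n, by simp⟩) ∘
      (fun ω (j : ({n} : Finset ℕ)) => ε j ω) := rfl
  rw [this, ← MeasurableSpace.comap_comp]
  exact MeasurableSpace.comap_mono (measurable_pi_apply _).comap_le

theorem map_prodMk_innov (h : IsChainInput P a ξ ε) {β : Type*} [MeasurableSpace β]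
    {n : ℕ} {X : Ω → β} (hX : Measurable[chainPast ξ ε n] X) :
    P.map (fun ω => (X ω, ε n ω)) = (P.map X).prod uniformSquare := by
  rw [(indepFun_innov_of_chainPast h hX).map_prod_eq_prod_map_map
    (hX.mono (chainPast_le h n) le_rfl).aemeasurable (h.measurable_innov n).aemeasurable,
    h.law_innov]

/-- Started from `ν`, the chain is stationary. -/
theorem map_chain (ha : 0 < a) (h : IsChainInput P a ξ ε) (n : ℕ) :
    P.map (chain a ξ ε n) = nuLaw a := by
  induction n with
  | zero => exact h.law_init
  | succ n ih =>
    have h1 : chain a ξ ε (n + 1) =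
        (fun q : ℝ × (ℝ × ℝ) => chainStep a q.2 q.1) ∘ fun ω => (chain a ξ ε n ω, ε n ω) := rfl
    rw [h1, ← Measure.map_map (measurable_chainStep ha)
      ((measurable_chain ha h n).prodMk (h.measurable_innov n)),
      map_prodMk_innov h (measurable_chain_chainPast ha le_rfl), ih, map_chainStep_nuLaw ha]

theorem ae_chain_mem_Icc (ha : 0 < a) (h : IsChainInput P a ξ ε) (n : ℕ) :
    ∀ᵐ ω ∂P, chain a ξ ε n ω ∈ Icc (0 : ℝ) 1 := by
  have := ae_mem_Icc_nuLaw a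
  rw [← map_chain ha h n] at this
  exact ae_of_ae_map (measurable_chain ha h n).aemeasurable this

omit [IsProbabilityMeasure P] in
theorem ae_innov_mem_Icc (h : IsChainInput P a ξ ε) (n : ℕ) :
    ∀ᵐ ω ∂P, (ε n ω).1 ∈ Icc (0 : ℝ) 1 ∧ (ε n ω).2 ∈ Icc (0 : ℝ) 1 := by
  have h1 : ∀ᵐ e ∂uniformSquare, e ∈ Icc (0 : ℝ) 1 ×ˢ Icc (0 : ℝ) 1 :=
    ae_restrict_mem (measurableSet_Icc.prod measurableSet_Icc)
  rw [← h.law_innov n] at h1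
  filter_upwards [ae_of_ae_map (h.measurable_innov n).aemeasurable h1] with ω hω using hω

/-- Increments whose conditional mean given the past vanishes are orthogonal to the past. -/
theorem integral_mul_eq_zero_of_chainPast (ha : 0 < a) (h : IsChainInput P a ξ ε) {n : ℕ}
    {X : Ω → ℝ} (hX : Measurable[chainPast ξ ε n] X) {B C : ℝ} (hXB : ∀ᵐ ω ∂P, |X ω| ≤ B)
    {φ : ℝ → ℝ × ℝ → ℝ} (hφ : Measurable fun q : ℝ × (ℝ × ℝ) => φ q.1 q.2)
    (hφC : ∀ w ∈ Icc (0 : ℝ) 1, ∀ e, |φ w e| ≤ C)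
    (hφ0 : ∀ w ∈ Icc (0 : ℝ) 1, ∫ e, φ w e ∂uniformSquare = 0) :
    ∫ ω, X ω * φ (chain a ξ ε n ω) (ε n ω) ∂P = 0 := by
  have hW := measurable_chain_chainPast (ξ := ξ) (ε := ε) ha (le_refl n)
  have hX' := hX.mono (chainPast_le h n) le_rfl
  have hW' := measurable_chain ha h n
  have hmap := map_prodMk_innov h (hX.prodMk hW)
  have := Measure.isProbabilityMeasure_map (μ := P) (hX'.prodMk hW').aemeasurable
  have hpair := (hX'.prodMk hW').prodMk (h.measurable_innov n)
  have hG : Measurable fun q : (ℝ × ℝ) × (ℝ × ℝ) => q.1.1 * φ q.1.2 q.2 := by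
    have : Measurable fun q : (ℝ × ℝ) × (ℝ × ℝ) => φ q.1.2 q.2 :=
      hφ.comp (f := fun q : (ℝ × ℝ) × (ℝ × ℝ) => (q.1.2, q.2)) (by fun_prop)
    fun_prop
  have hbound : ∀ᵐ ω ∂P, ‖X ω * φ (chain a ξ ε n ω) (ε n ω)‖ ≤ B * C := by
    filter_upwards [hXB, ae_chain_mem_Icc ha h n] with ω h1 h2
    rw [Real.norm_eq_abs, abs_mul]
    exact mul_le_mul h1 (hφC _ h2 _) (abs_nonneg _) ((abs_nonneg _).trans h1)
  have hint := Integrable.of_bound (hG.comp hpair).aestronglyMeasurable (B * C) hbound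
  rw [← integral_map (μ := P) (φ := fun ω => ((X ω, chain a ξ ε n ω), ε n ω))
    (f := fun q : (ℝ × ℝ) × (ℝ × ℝ) => q.1.1 * φ q.1.2 q.2)
    hpair.aemeasurable hG.aestronglyMeasurable, hmap, integral_prod]
  · refine integral_eq_zero_of_ae ?_
    have hI : ∀ᵐ q ∂(P.map fun ω => (X ω, chain a ξ ε n ω)), q.2 ∈ Icc (0 : ℝ) 1 := by
      rw [ae_map_iff (hX'.prodMk hW').aemeasurable (measurable_snd measurableSet_Icc)]
      exact ae_chain_mem_Icc ha h n
    filter_upwards [hI] with q hq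
    simp only [Pi.zero_apply]
    rw [integral_const_mul, hφ0 q.2 hq, mul_zero]
  · rw [← hmap]
    exact (integrable_map_measure hG.aestronglyMeasurable hpair.aemeasurable).2 hint

end Chain

/-! ### A martingale counting the jumps to low points -/

/-- The test function `w ↦ min (1 / w) K` (for `w > 0`). Before truncation, `1 / w` solves a Poisson
equation: its drift under the kernel is `w * ∫ (1 / x) dπ - 1`, which turns the jump intensity `w`
into a constant. The truncation makes second moments finite. -/
noncomputable def truncInv (K w : ℝ) : ℝ := (max w K⁻¹)⁻¹

theorem measurable_truncInv (K : ℝ) : Measurable (truncInv K) := by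
  unfold truncInv; fun_prop

theorem truncInv_nonneg {K : ℝ} (hK : 1 ≤ K) (w : ℝ) : 0 ≤ truncInv K w := by
  have : 0 < K⁻¹ := by positivity
  exact inv_nonneg.2 (this.le.trans (le_max_right _ _))

theorem truncInv_le {K : ℝ} (hK : 1 ≤ K) (w : ℝ) : truncInv K w ≤ K := by
  have : 0 < K⁻¹ := by positivity
  have h2 := inv_anti₀ this (le_max_right w K⁻¹)
  rwa [inv_inv] at h2

theorem mul_truncInv_mem {K w : ℝ} (hK : 1 ≤ K) (hw : 0 ≤ w) :
    w * truncInv K w ∈ Icc (0 : ℝ) 1 := by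
  have : 0 < K⁻¹ := by positivity
  refine ⟨mul_nonneg hw (truncInv_nonneg hK w), ?_⟩
  rw [truncInv, ← div_eq_mul_inv]
  exact (div_le_one (this.trans_le (le_max_right _ _))).2 (le_max_left _ _)

theorem mul_truncInv_eq_one {K w : ℝ} (hK : 1 ≤ K) (hw : K⁻¹ ≤ w) : w * truncInv K w = 1 := by
  have : 0 < K⁻¹ := by positivity
  rw [truncInv, max_eq_left hw, mul_inv_cancel₀ (this.trans_le hw).ne']

/-- The mean of `truncInv K` under `π`. -/
noncomputable def truncInvMean (a K : ℝ) : ℝ := ∫ v in Icc (0 : ℝ) 1, truncInv K (piQuantile a v)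

/-- The martingale increment, at a step started from `w` with innovation `e`, that compensates
`truncInvMean a K` times the indicator of a jump to a point below the `v`-quantile of `π`. The
conditional mean `truncInvMean a K * v * w` of that indicator is replaced by `v` times the increment
of `truncInv K` plus `v * (w * truncInv K w)`, where `w * truncInv K w = 1` for `w ≥ K⁻¹`. -/
noncomputable def jumpMartingale (a K v w : ℝ) (e : ℝ × ℝ) : ℝ :=
  truncInvMean a K * ((Iio w).indicator 1 e.1 * (Iic v).indicator 1 e.2)
    - v * ((Iio w).indicator 1 e.1 * (truncInv K (piQuantile a e.2) - truncInv K w))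
    - v * (w * truncInv K w)

theorem measurable_jumpMartingale {a : ℝ} (ha : 0 < a) (K v : ℝ) :
    Measurable fun q : ℝ × (ℝ × ℝ) => jumpMartingale a K v q.1 q.2 := by
  have h1 : Measurable fun q : ℝ × (ℝ × ℝ) => (Iio q.1).indicator (1 : ℝ → ℝ) q.2.1 := by
    have : (fun q : ℝ × (ℝ × ℝ) => (Iio q.1).indicator (1 : ℝ → ℝ) q.2.1) =
        {q : ℝ × (ℝ × ℝ) | q.2.1 < q.1}.indicator 1 := by
      ext q; simp [indicator]
    rw [this]
    exact measurable_one.indicator (measurableSet_lt (by fun_prop) (by fun_prop))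
  have h2 : Measurable fun q : ℝ × (ℝ × ℝ) => (Iic v).indicator (1 : ℝ → ℝ) q.2.2 :=
    (measurable_one.indicator measurableSet_Iic).comp (by fun_prop)
  have h3 : Measurable fun q : ℝ × (ℝ × ℝ) => truncInv K (piQuantile a q.2.2) :=
    ((measurable_truncInv K).comp (measurable_piQuantile ha)).comp (by fun_prop)
  have h4 : Measurable fun q : ℝ × (ℝ × ℝ) => truncInv K q.1 :=
    (measurable_truncInv K).comp (by fun_prop)
  unfold jumpMartingale
  fun_prop

theorem integrable_truncInv_piQuantile {a K : ℝ} (ha : 0 < a) (hK : 1 ≤ K) :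
    Integrable (fun v => truncInv K (piQuantile a v)) (volume.restrict (Icc (0 : ℝ) 1)) := by
  refine Integrable.of_bound
    ((measurable_truncInv K).comp (measurable_piQuantile ha)).aestronglyMeasurable K
    (ae_of_all _ fun v => ?_)
  rw [Real.norm_of_nonneg (truncInv_nonneg hK _)]
  exact truncInv_le hK _

theorem truncInvMean_mem {a K : ℝ} (ha : 0 < a) (hK : 1 ≤ K) :
    truncInvMean a K ∈ Icc (0 : ℝ) K := by
  refine ⟨integral_nonneg fun v => truncInv_nonneg hK _, ?_⟩
  calc truncInvMean a K ≤ ∫ v in Icc (0 : ℝ) 1, K :=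
        integral_mono (integrable_truncInv_piQuantile ha hK) (integrable_const _)
          fun v => truncInv_le hK _
    _ = K := by simp

theorem integral_jumpMartingale {a K v w : ℝ} (ha : 0 < a) (hK : 1 ≤ K) (hv : v ∈ Icc (0 : ℝ) 1)
    (hw : w ∈ Icc (0 : ℝ) 1) : ∫ e, jumpMartingale a K v w e ∂uniformSquare = 0 := by
  have i1 : ∫ u in Icc (0 : ℝ) 1, (Iio w).indicator (1 : ℝ → ℝ) u = w := by
    rw [integral_indicator_one measurableSet_Iio, measureReal_def, unitUniform_Iio hw,
      ENNReal.toReal_ofReal hw.1]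
  have i2 : ∫ u in Icc (0 : ℝ) 1, (Iic v).indicator (1 : ℝ → ℝ) u = v := by
    rw [integral_indicator_one measurableSet_Iic, measureReal_def, unitUniform_Iic hv,
      ENNReal.toReal_ofReal hv.1]
  have j1 : Integrable ((Iio w).indicator (1 : ℝ → ℝ)) (volume.restrict (Icc (0 : ℝ) 1)) :=
    (integrable_const (1 : ℝ)).indicator measurableSet_Iio
  have j2 : Integrable ((Iic v).indicator (1 : ℝ → ℝ)) (volume.restrict (Icc (0 : ℝ) 1)) :=
    (integrable_const (1 : ℝ)).indicator measurableSet_Iic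
  have j3 := (integrable_truncInv_piQuantile ha hK).sub (integrable_const (truncInv K w))
  have i3 : ∫ u in Icc (0 : ℝ) 1, (truncInv K (piQuantile a u) - truncInv K w)
      = truncInvMean a K - truncInv K w := by
    rw [integral_sub (integrable_truncInv_piQuantile ha hK) (integrable_const _)]
    simp [truncInvMean]
  unfold jumpMartingale
  rw [uniformSquare_eq_prod, integral_sub, integral_sub, integral_const_mul, integral_const_mul,
    integral_prod_mul (fun u => (Iio w).indicator (1 : ℝ → ℝ) u)
      (fun u => (Iic v).indicator (1 : ℝ → ℝ) u),
    integral_prod_mul (fun u => (Iio w).indicator (1 : ℝ → ℝ) u)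
      (fun u => truncInv K (piQuantile a u) - truncInv K w), i1, i2, i3, integral_const]
  · simp; ring
  · exact (j1.mul_prod j2).const_mul _
  · exact (j1.mul_prod j3).const_mul _
  · exact ((j1.mul_prod j2).const_mul _).sub ((j1.mul_prod j3).const_mul _)
  · exact integrable_const _

theorem jumpMartingale_sq_le {a K v w : ℝ} (ha : 0 < a) (hK : 1 ≤ K) (hv : v ∈ Icc (0 : ℝ) 1)
    (hw : w ∈ Icc (0 : ℝ) 1) (e : ℝ × ℝ) :
    jumpMartingale a K v w e ^ 2 ≤ 2 * K ^ 2 * (Iic v).indicator 1 e.2 + 8 * K ^ 2 * v := by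
  obtain ⟨c0, c1⟩ := truncInvMean_mem ha hK
  obtain ⟨m0, m1⟩ := mul_truncInv_mem hK hw.1
  have q0 := truncInv_nonneg hK (piQuantile a e.2)
  have q1 := truncInv_le hK (piQuantile a e.2)
  have w0 := truncInv_nonneg hK w
  have w1 := truncInv_le hK w
  have hI : ∀ (s : Set ℝ) (x : ℝ), s.indicator (1 : ℝ → ℝ) x = 0 ∨
      s.indicator (1 : ℝ → ℝ) x = 1 := by
    intro s x
    by_cases hx : x ∈ s <;> simp [hx]
  unfold jumpMartingale
  set c := truncInvMean a K
  set m := w * truncInv K w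
  set i := (Iio w).indicator (1 : ℝ → ℝ) e.1
  set j := (Iic v).indicator (1 : ℝ → ℝ) e.2 with hj
  set d := truncInv K (piQuantile a e.2) - truncInv K w
  have hx : (c * (i * j)) ^ 2 ≤ K ^ 2 * j := by
    rcases hI (Iio w) e.1 with h1 | h1 <;> rcases hI (Iic v) e.2 with h2 | h2 <;>
      simp only [i, j, h1, h2] <;> nlinarith
  have hy : (i * d + m) ^ 2 ≤ (2 * K) ^ 2 := by
    refine sq_le_sq' ?_ ?_ <;> rcases hI (Iio w) e.1 with h1 | h1 <;> simp only [i, h1] <;> linarith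
  have hv2 : v ^ 2 ≤ v := by nlinarith [hv.1, hv.2]
  calc (c * (i * j) - v * (i * d) - v * m) ^ 2 = (c * (i * j) - v * (i * d + m)) ^ 2 := by ring
    _ ≤ 2 * (c * (i * j)) ^ 2 + 2 * (v * (i * d + m)) ^ 2 := by
        nlinarith [sq_nonneg (c * (i * j) + v * (i * d + m))]
    _ = 2 * (c * (i * j)) ^ 2 + 2 * (v ^ 2 * (i * d + m) ^ 2) := by ring
    _ ≤ 2 * (K ^ 2 * j) + 2 * (v * (2 * K) ^ 2) := by
        have := mul_le_mul hv2 hy (sq_nonneg _) hv.1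
        linarith
    _ = _ := by ring

-- Unification in measurability goals for compositions with the chain would unfold these.
attribute [irreducible] jumpMartingale truncInv truncInvMean

theorem abs_jumpMartingale_le {a K v w : ℝ} (ha : 0 < a) (hK : 1 ≤ K) (hv : v ∈ Icc (0 : ℝ) 1)
    (hw : w ∈ Icc (0 : ℝ) 1) (e : ℝ × ℝ) : |jumpMartingale a K v w e| ≤ 4 * K := by
  have hKpos : 0 < K := by linarith
  refine abs_le_of_sq_le_sq ?_ (by positivity)
  have h1 := jumpMartingale_sq_le ha hK hv hw e
  have h2 : (Iic v).indicator (1 : ℝ → ℝ) e.2 ≤ 1 := indicator_le_self' (by simp) _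
  have h3 := mul_le_mul_of_nonneg_left h2 (by positivity : (0 : ℝ) ≤ 2 * K ^ 2)
  have h4 := mul_le_mul_of_nonneg_left hv.2 (by positivity : (0 : ℝ) ≤ 8 * K ^ 2)
  have h5 : (4 * K) ^ 2 = 16 * K ^ 2 := by ring
  linarith [sq_nonneg K]

section Chain

variable {Ω : Type*} {ξ : Ω → ℝ} {ε : ℕ → Ω → ℝ × ℝ} {a : ℝ} [MeasurableSpace Ω] {P : Measure Ω}
  [IsProbabilityMeasure P]

/-- The partial sums from `M` to `N` of `jumpMartingale` along the chain. -/
noncomputable def jumpMartingaleSum (a K : ℝ) (v : ℕ → ℝ) (ξ : Ω → ℝ) (ε : ℕ → Ω → ℝ × ℝ) (M N : ℕ)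
    (ω : Ω) : ℝ :=
  ∑ n ∈ Finset.Ico M N, jumpMartingale a K (v n) (chain a ξ ε n ω) (ε n ω)

omit [MeasurableSpace Ω] in
theorem measurable_jumpMartingaleSum (ha : 0 < a) (K : ℝ) (v : ℕ → ℝ) (M N : ℕ) :
    Measurable[chainPast ξ ε N] (jumpMartingaleSum a K v ξ ε M N) := by
  refine Finset.measurable_fun_sum (m := chainPast ξ ε N) _ fun n hn => ?_
  have hn := (Finset.mem_Ico.1 hn).2
  exact (measurable_jumpMartingale ha K (v n)).comp
    ((measurable_chain_chainPast ha hn.le).prodMk (measurable_innov_chainPast hn))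

omit [IsProbabilityMeasure P] in
theorem measureReal_innov_snd_le (h : IsChainInput P a ξ ε) (n : ℕ) {v : ℝ}
    (hv : v ∈ Icc (0 : ℝ) 1) :
    P.real {ω | (ε n ω).2 ≤ v} = v := by
  have h1 : P {ω | (ε n ω).2 ≤ v} = uniformSquare (univ ×ˢ Iic v) := by
    rw [← h.law_innov n, Measure.map_apply (h.measurable_innov n)
      (MeasurableSet.univ.prod measurableSet_Iic)]
    congr 1
    ext ω
    simp
  rw [measureReal_def, h1, uniformSquare_eq_prod, Measure.prod_prod, measure_univ, one_mul,
    unitUniform_Iic hv, ENNReal.toReal_ofReal hv.1]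

omit [IsProbabilityMeasure P] in
theorem integrable_mul_of_ae_bdd [IsFiniteMeasure P] {f g : Ω → ℝ} {x y : ℝ} (hf : Measurable f)
    (hg : Measurable g) (hx : ∀ᵐ ω ∂P, |f ω| ≤ x) (hy : ∀ᵐ ω ∂P, |g ω| ≤ y) :
    Integrable (fun ω => f ω * g ω) P := by
  refine Integrable.of_bound (hf.mul hg).aestronglyMeasurable (x * y) ?_
  filter_upwards [hx, hy] with ω h1 h2
  rw [Real.norm_eq_abs, abs_mul]
  exact mul_le_mul h1 h2 (abs_nonneg _) ((abs_nonneg _).trans h1)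

theorem integral_jumpMartingale_sq_le (ha : 0 < a) (h : IsChainInput P a ξ ε) {K : ℝ} (hK : 1 ≤ K)
    (n : ℕ) {v : ℝ} (hv : v ∈ Icc (0 : ℝ) 1) :
    ∫ ω, jumpMartingale a K v (chain a ξ ε n ω) (ε n ω) ^ 2 ∂P ≤ 10 * K ^ 2 * v := by
  have hDm : Measurable fun ω => jumpMartingale a K v (chain a ξ ε n ω) (ε n ω) :=
    (measurable_jumpMartingale ha K v).comp
      ((measurable_chain ha h n).prodMk (h.measurable_innov n))
  have hDb : ∀ᵐ ω ∂P, |jumpMartingale a K v (chain a ξ ε n ω) (ε n ω)| ≤ 4 * K := by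
    filter_upwards [ae_chain_mem_Icc ha h n] with ω hω using abs_jumpMartingale_le ha hK hv hω _
  have hs : MeasurableSet {ω | (ε n ω).2 ≤ v} :=
    measurableSet_le (measurable_snd.comp (h.measurable_innov n)) measurable_const
  have hi : Integrable ({ω | (ε n ω).2 ≤ v}.indicator (1 : Ω → ℝ)) P :=
    (integrable_const (1 : ℝ)).indicator hs
  calc _ ≤ ∫ ω, (2 * K ^ 2 * {ω | (ε n ω).2 ≤ v}.indicator (1 : Ω → ℝ) ω + 8 * K ^ 2 * v) ∂P := by
        refine integral_mono_ae ?_ ((hi.const_mul _).add (integrable_const _)) ?_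
        · simp_rw [pow_two]
          exact integrable_mul_of_ae_bdd hDm hDm hDb hDb
        · filter_upwards [ae_chain_mem_Icc ha h n] with ω hω
          exact jumpMartingale_sq_le ha hK hv hω _
    _ = 10 * K ^ 2 * v := by
        rw [integral_add (hi.const_mul _) (integrable_const _), integral_const_mul,
          integral_indicator_one hs, measureReal_innov_snd_le h n hv]
        simp
        ring

/-- By orthogonality of the increments, the second moment grows like the sum of the weights. The
almost sure bound is carried along for integrability. -/
theorem integral_jumpMartingaleSum_sq_le (ha : 0 < a) (h : IsChainInput P a ξ ε) {K : ℝ}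
    (hK : 1 ≤ K)
    {v : ℕ → ℝ} (hv : ∀ n, v n ∈ Icc (0 : ℝ) 1) (M N : ℕ) :
    (∃ B, ∀ᵐ ω ∂P, |jumpMartingaleSum a K v ξ ε M N ω| ≤ B) ∧
    ∫ ω, jumpMartingaleSum a K v ξ ε M N ω ^ 2 ∂P ≤ 10 * K ^ 2 * ∑ n ∈ Finset.Ico M N, v n := by
  have hKpos : 0 < K := by linarith
  induction N with
  | zero => exact ⟨⟨0, by simp [jumpMartingaleSum]⟩, by simp [jumpMartingaleSum]⟩
  | succ N ih =>
    rcases lt_or_ge N M with hNM | hNM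
    · have : Finset.Ico M (N + 1) = ∅ := Finset.Ico_eq_empty (by omega)
      exact ⟨⟨0, by simp [jumpMartingaleSum, this]⟩, by simp [jumpMartingaleSum, this]⟩
    obtain ⟨⟨B, hB⟩, hint⟩ := ih
    have hsum : ∀ ω, jumpMartingaleSum a K v ξ ε M (N + 1) ω = jumpMartingaleSum a K v ξ ε M N ω
        + jumpMartingale a K (v N) (chain a ξ ε N ω) (ε N ω) := fun ω => by
      rw [jumpMartingaleSum, Finset.sum_Ico_succ_top hNM, jumpMartingaleSum]
    have hDb := fun w hw => abs_jumpMartingale_le (w := w) ha hK (hv N) hw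
    have hSm := measurable_jumpMartingaleSum (ξ := ξ) (ε := ε) ha K v M N
    have hSm' := hSm.mono (chainPast_le h N) le_rfl
    have hDm : Measurable fun ω => jumpMartingale a K (v N) (chain a ξ ε N ω) (ε N ω) :=
      (measurable_jumpMartingale ha K (v N)).comp
        ((measurable_chain ha h N).prodMk (h.measurable_innov N))
    have horth := integral_mul_eq_zero_of_chainPast ha h hSm hB
        (measurable_jumpMartingale ha K (v N))
      hDb fun w hw => integral_jumpMartingale ha hK (hv N) hw
    have hDb' : ∀ᵐ ω ∂P, |jumpMartingale a K (v N) (chain a ξ ε N ω) (ε N ω)| ≤ 4 * K := by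
      filter_upwards [ae_chain_mem_Icc ha h N] with ω hω using hDb _ hω _
    have hDsq := integral_jumpMartingale_sq_le ha h hK N (hv N)
    refine ⟨⟨B + 4 * K, ?_⟩, ?_⟩
    · filter_upwards [hB, hDb'] with ω h1 h2
      rw [hsum]
      exact (abs_add_le _ _).trans (add_le_add h1 h2)
    · rw [Finset.sum_Ico_succ_top hNM, mul_add]
      have hexp : ∀ ω, jumpMartingaleSum a K v ξ ε M (N + 1) ω ^ 2 =
          (jumpMartingaleSum a K v ξ ε M N ω ^ 2 + 2 * (jumpMartingaleSum a K v ξ ε M N ω *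
            jumpMartingale a K (v N) (chain a ξ ε N ω) (ε N ω)))
          + jumpMartingale a K (v N) (chain a ξ ε N ω) (ε N ω) ^ 2 := fun ω => by
        rw [hsum]; ring
      have e1 : Integrable (fun ω => jumpMartingaleSum a K v ξ ε M N ω ^ 2) P := by
        simp_rw [pow_two]; exact integrable_mul_of_ae_bdd hSm' hSm' hB hB
      have e2 := (integrable_mul_of_ae_bdd hSm' hDm hB hDb').const_mul 2
      have e3 : Integrable (fun ω => jumpMartingale a K (v N) (chain a ξ ε N ω) (ε N ω) ^ 2) P := by
        simp_rw [pow_two]; exact integrable_mul_of_ae_bdd hDm hDm hDb' hDb'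
      simp_rw [hexp]
      have e12 : Integrable (fun ω => jumpMartingaleSum a K v ξ ε M N ω ^ 2 +
          2 * (jumpMartingaleSum a K v ξ ε M N ω *
            jumpMartingale a K (v N) (chain a ξ ε N ω) (ε N ω))) P := e1.add e2
      rw [integral_add e12 e3, integral_add e1 e2, integral_const_mul, horth]
      linarith

omit [MeasurableSpace Ω] in
/-- As long as no jump to a point below the prescribed quantiles occurs, the martingale decreases
like the sum of the weights `v n`, up to the weights of the times where the chain is below `K⁻¹`. -/
theorem sum_sub_le_neg_jumpMartingaleSum {K : ℝ} (hK : 1 ≤ K) {v : ℕ → ℝ}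
    (hv : ∀ n, v n ∈ Icc (0 : ℝ) 1) (hva : Antitone v) {M N : ℕ} (hMN : M ≤ N) {ω : Ω}
    (hW : ∀ n, chain a ξ ε n ω ∈ Icc (0 : ℝ) 1)
    (hno : ∀ n, M ≤ n → ¬ ((ε n ω).1 < chain a ξ ε n ω ∧ (ε n ω).2 ≤ v n)) :
    ∑ n ∈ Finset.Ico M N, v n - ∑ n ∈ Finset.Ico M N, v n * (Iio K⁻¹).indicator 1 (chain a ξ ε n ω)
      - K ≤ - jumpMartingaleSum a K v ξ ε M N ω := by
  -- bound the weighted increments of `truncInv K` by a telescoping sum, as `v` is antitone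
  suffices H : ∑ n ∈ Finset.Ico M N, v n
      - ∑ n ∈ Finset.Ico M N, v n * (Iio K⁻¹).indicator 1 (chain a ξ ε n ω)
      - (v M * truncInv K (chain a ξ ε M ω) - v N * truncInv K (chain a ξ ε N ω))
      ≤ - jumpMartingaleSum a K v ξ ε M N ω by
    have h1 : v M * truncInv K (chain a ξ ε M ω) ≤ 1 * K :=
      mul_le_mul (hv M).2 (truncInv_le hK _) (truncInv_nonneg hK _) zero_le_one
    have h2 := mul_nonneg (hv N).1 (truncInv_nonneg hK (chain a ξ ε N ω))
    linarith
  induction N, hMN using Nat.le_induction with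
  | base => simp [jumpMartingaleSum]
  | succ N hMN ih =>
    have hsum : jumpMartingaleSum a K v ξ ε M (N + 1) ω = jumpMartingaleSum a K v ξ ε M N ω
        + jumpMartingale a K (v N) (chain a ξ ε N ω) (ε N ω) := by
      rw [jumpMartingaleSum, Finset.sum_Ico_succ_top hMN, jumpMartingaleSum]
    rw [Finset.sum_Ico_succ_top hMN, Finset.sum_Ico_succ_top hMN, hsum]
    have hstep : chain a ξ ε (N + 1) ω = chainStep a (ε N ω) (chain a ξ ε N ω) := rfl
    have hD : jumpMartingale a K (v N) (chain a ξ ε N ω) (ε N ω) =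
        - (v N * (truncInv K (chain a ξ ε (N + 1) ω) - truncInv K (chain a ξ ε N ω)))
        - v N * (chain a ξ ε N ω * truncInv K (chain a ξ ε N ω)) := by
      rw [hstep, jumpMartingale, chainStep]
      by_cases hj : (ε N ω).1 < chain a ξ ε N ω
      · have h2 : ¬ (ε N ω).2 ≤ v N := fun h2 => hno N hMN ⟨hj, h2⟩
        simp [hj, h2, not_le.2 hj]
      · simp [hj, not_lt.1 hj]
    have hlow : v N - v N * (Iio K⁻¹).indicator 1 (chain a ξ ε N ω)
        ≤ v N * (chain a ξ ε N ω * truncInv K (chain a ξ ε N ω)) := by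
      rcases lt_or_ge (chain a ξ ε N ω) K⁻¹ with hlt | hge
      · simp only [mem_Iio, hlt, indicator_of_mem, Pi.one_apply, mul_one, sub_self]
        exact mul_nonneg (hv N).1 (mul_truncInv_mem hK (hW N).1).1
      · rw [mul_truncInv_eq_one hK hge]
        simp [hge]
    have hmono : v (N + 1) * truncInv K (chain a ξ ε (N + 1) ω)
        ≤ v N * truncInv K (chain a ξ ε (N + 1) ω) :=
      mul_le_mul_of_nonneg_right (hva N.le_succ) (truncInv_nonneg hK _)
    rw [hD]
    linarith

end Chain

/-! ### Low jumps and long holding periods -/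

section Chain

variable {Ω : Type*} {ξ : Ω → ℝ} {ε : ℕ → Ω → ℝ × ℝ} {a : ℝ} [MeasurableSpace Ω] {P : Measure Ω}
  [IsProbabilityMeasure P]

theorem measureReal_chain_lt_le (ha : 0 < a) (h : IsChainInput P a ξ ε) (n : ℕ) {x : ℝ}
    (hx : x ∈ Icc (0 : ℝ) 1) : P.real {ω | chain a ξ ε n ω < x} ≤ x ^ a := by
  have h1 : P {ω | chain a ξ ε n ω < x} ≤ nuLaw a (Iic x) := by
    rw [← map_chain ha h n, Measure.map_apply (measurable_chain ha h n) measurableSet_Iic]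
    exact measure_mono fun ω (hω : _ < x) => hω.le
  rw [nuLaw_Iic ha hx] at h1
  exact ENNReal.toReal_le_of_le_ofReal (Real.rpow_nonneg hx.1 _) h1

/-- Quantitative form of `ae_exists_low_jump`: the first term bounds the chance that the chain
spends half of the weight below `K⁻¹`, the second is Chebyshev's inequality for the martingale. -/
theorem measureReal_no_low_jump_le (ha : 0 < a) (h : IsChainInput P a ξ ε) {K : ℝ} (hK : 1 ≤ K)
    {v : ℕ → ℝ} (hv : ∀ n, v n ∈ Icc (0 : ℝ) 1) (hva : Antitone v) {M N : ℕ} (hMN : M ≤ N)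
    (hV : 4 * K ≤ ∑ n ∈ Finset.Ico M N, v n) :
    P.real {ω | (∀ n, chain a ξ ε n ω ∈ Icc (0 : ℝ) 1) ∧
      ∀ n, M ≤ n → ¬ ((ε n ω).1 < chain a ξ ε n ω ∧ (ε n ω).2 ≤ v n)}
      ≤ 2 * K⁻¹ ^ a + 160 * K ^ 2 / ∑ n ∈ Finset.Ico M N, v n := by
  have hKpos : 0 < K := by linarith
  have hKi : K⁻¹ ∈ Icc (0 : ℝ) 1 := ⟨by positivity, inv_le_one_of_one_le₀ hK⟩
  set V := ∑ n ∈ Finset.Ico M N, v n with hVdef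
  have hVpos : 0 < V := by linarith
  set R : Ω → ℝ := fun ω => ∑ n ∈ Finset.Ico M N, v n * (Iio K⁻¹).indicator 1 (chain a ξ ε n ω)
    with hR
  set S := jumpMartingaleSum a K v ξ ε M N with hS
  have hWs : ∀ n, MeasurableSet {ω | chain a ξ ε n ω < K⁻¹} := fun n =>
    measurableSet_lt (measurable_chain ha h n) measurable_const
  have hind : ∀ n, (fun ω => (Iio K⁻¹).indicator (1 : ℝ → ℝ) (chain a ξ ε n ω)) =
      {ω | chain a ξ ε n ω < K⁻¹}.indicator 1 := fun n => by ext ω; simp [indicator]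
  have hRi : ∀ n ∈ Finset.Ico M N,
      Integrable (fun ω => v n * (Iio K⁻¹).indicator (1 : ℝ → ℝ) (chain a ξ ε n ω)) P := by
    intro n _
    refine Integrable.const_mul ?_ _
    rw [hind]
    exact (integrable_const (1 : ℝ)).indicator (hWs n)
  have hER : ∫ ω, R ω ∂P ≤ V * K⁻¹ ^ a := by
    rw [integral_finsetSum _ hRi, hVdef, Finset.sum_mul]
    refine Finset.sum_le_sum fun n _ => ?_
    rw [integral_const_mul, hind, integral_indicator_one (hWs n)]
    exact mul_le_mul_of_nonneg_left (measureReal_chain_lt_le ha h n hKi) (hv n).1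
  have hR0 : 0 ≤ᵐ[P] R := ae_of_all _ fun ω => Finset.sum_nonneg fun n _ =>
    mul_nonneg (hv n).1 (indicator_nonneg (by simp) _)
  have m1 := mul_meas_ge_le_integral_of_nonneg hR0 (integrable_finsetSum _ hRi) (V / 2)
  obtain ⟨⟨B, hB⟩, hES⟩ := integral_jumpMartingaleSum_sq_le ha h hK hv M N
  have hSm : Measurable S :=
    (measurable_jumpMartingaleSum ha K v M N).mono (chainPast_le h N) le_rfl
  have hSi : Integrable (fun ω => S ω ^ 2) P := by
    simp_rw [pow_two]; exact integrable_mul_of_ae_bdd hSm hSm hB hB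
  have m2 := mul_meas_ge_le_integral_of_nonneg (ae_of_all P fun ω => sq_nonneg (S ω)) hSi
    ((V / 4) ^ 2)
  have hsub : {ω | (∀ n, chain a ξ ε n ω ∈ Icc (0 : ℝ) 1) ∧
      ∀ n, M ≤ n → ¬ ((ε n ω).1 < chain a ξ ε n ω ∧ (ε n ω).2 ≤ v n)} ⊆
      {ω | V / 2 ≤ R ω} ∪ {ω | (V / 4) ^ 2 ≤ S ω ^ 2} := by
    rintro ω ⟨hW, hno⟩
    have h1 : V - R ω - K ≤ - S ω := sum_sub_le_neg_jumpMartingaleSum hK hv hva hMN hW hno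
    rcases le_or_gt (V / 2) (R ω) with h2 | h2
    · exact Or.inl h2
    · refine Or.inr ?_
      have : V / 4 ≤ - S ω := by linarith
      change (V / 4) ^ 2 ≤ S ω ^ 2
      rw [← neg_sq (S ω)]
      exact pow_le_pow_left₀ (by positivity) this 2
  calc _ ≤ P.real {ω | V / 2 ≤ R ω} + P.real {ω | (V / 4) ^ 2 ≤ S ω ^ 2} :=
        (measureReal_mono hsub).trans (measureReal_union_le _ _)
    _ ≤ 2 * K⁻¹ ^ a + 160 * K ^ 2 / V := by
        refine add_le_add ?_ ?_
        · refine le_of_mul_le_mul_left (a := V / 2) ?_ (by positivity)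
          refine (m1.trans hER).trans_eq (by ring)
        · refine le_of_mul_le_mul_left (a := (V / 4) ^ 2) ?_ (by positivity)
          refine (m2.trans hES).trans_eq ?_
          rw [← hVdef]
          field_simp
          ring

/-- If `∑ v n = ∞`, then almost surely the chain jumps below the `v n`-quantile of `π` infinitely
often. -/
theorem ae_exists_low_jump (ha : 0 < a) (h : IsChainInput P a ξ ε)
    {v : ℕ → ℝ} (hv : ∀ n, v n ∈ Icc (0 : ℝ) 1) (hva : Antitone v) (hvs : ¬ Summable v) (M : ℕ) :
    ∀ᵐ ω ∂P, ∃ n, M ≤ n ∧ (ε n ω).1 < chain a ξ ε n ω ∧ (ε n ω).2 ≤ v n := by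
  set E := {ω | (∀ n, chain a ξ ε n ω ∈ Icc (0 : ℝ) 1) ∧
      ∀ n, M ≤ n → ¬ ((ε n ω).1 < chain a ξ ε n ω ∧ (ε n ω).2 ≤ v n)}
  have hsum : Tendsto (fun N => ∑ n ∈ Finset.Ico M N, v n) atTop atTop := by
    have h1 := (not_summable_iff_tendsto_nat_atTop_of_nonneg fun n => (hv n).1).1 hvs
    have h2 := tendsto_atTop_add_const_right atTop (-∑ n ∈ Finset.range M, v n) h1
    refine h2.congr' ?_
    filter_upwards [eventually_ge_atTop M] with N hN
    rw [Finset.sum_Ico_eq_sub _ hN, sub_eq_add_neg]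
  have hE : P.real E ≤ 0 := by
    have hlim : Tendsto (fun K : ℝ => 2 * K⁻¹ ^ a) atTop (𝓝 0) := by
      have := (tendsto_rpow_neg_atTop ha).const_mul 2
      rw [mul_zero] at this
      refine this.congr' ?_
      filter_upwards [eventually_gt_atTop 0] with K hK
      rw [Real.inv_rpow hK.le, Real.rpow_neg hK.le]
    refine ge_of_tendsto hlim ?_
    filter_upwards [eventually_ge_atTop 1] with K hK
    have hlim2 : Tendsto (fun N => 2 * K⁻¹ ^ a + 160 * K ^ 2 / ∑ n ∈ Finset.Ico M N, v n) atTop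
        (𝓝 (2 * K⁻¹ ^ a + 0)) := tendsto_const_nhds.add (hsum.const_div_atTop _)
    rw [add_zero] at hlim2
    refine ge_of_tendsto hlim2 ?_
    filter_upwards [hsum.eventually_ge_atTop (4 * K), eventually_ge_atTop M] with N hN hMN
    exact measureReal_no_low_jump_le ha h hK hv hva hMN hN
  have hE0 : P E = 0 := by
    rw [← measureReal_eq_zero_iff]
    exact le_antisymm hE measureReal_nonneg
  filter_upwards [measure_eq_zero_iff_ae_notMem.1 hE0, ae_all_iff.2 (ae_chain_mem_Icc ha h)]
    with ω h1 h2
  by_contra hcon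
  push Not at hcon
  exact h1 ⟨h2, fun n hn hA => absurd hA.2 (not_le.2 (hcon n hn hA.1))⟩

omit [IsProbabilityMeasure P] in
theorem measure_innov_fst_lt_le (h : IsChainInput P a ξ ε) (n : ℕ) {x : ℝ}
    (hx : x ∈ Icc (0 : ℝ) 1) :
    P {ω | (ε n ω).1 < x} ≤ ENNReal.ofReal x := by
  have h1 : P {ω | (ε n ω).1 < x} = uniformSquare (Iio x ×ˢ univ) := by
    rw [← h.law_innov n, Measure.map_apply (h.measurable_innov n)
      (measurableSet_Iio.prod MeasurableSet.univ)]
    congr 1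
    ext ω
    simp
  rw [h1, uniformSquare_eq_prod, Measure.prod_prod, measure_univ, mul_one, unitUniform_Iio hx]

omit [IsProbabilityMeasure P] in
theorem measure_exists_innov_fst_lt_le (h : IsChainInput P a ξ ε) (T : Finset ℕ) {x : ℝ}
    (hx : x ∈ Icc (0 : ℝ) 1) :
    P {ω | ∃ j ∈ T, (ε j ω).1 < x} ≤ ENNReal.ofReal (T.card * x) := by
  have h1 : {ω | ∃ j ∈ T, (ε j ω).1 < x} = ⋃ j ∈ T, {ω | (ε j ω).1 < x} := by
    ext ω; simp
  rw [h1]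
  refine (measure_biUnion_finset_le _ _).trans ?_
  refine (Finset.sum_le_sum fun j _ => measure_innov_fst_lt_le h j hx).trans_eq ?_
  rw [Finset.sum_const, nsmul_eq_mul, ENNReal.ofReal_mul (by positivity), ENNReal.ofReal_natCast]

/-- With probability close to `1`, some jump below the `v n`-quantile after time `M` is followed by
a long holding period: decompose over the first such jump, which is independent of what follows. -/
theorem measure_no_long_hold_le (ha : 0 < a) (h : IsChainInput P a ξ ε)
    {v : ℕ → ℝ} (hv : ∀ n, v n ∈ Icc (0 : ℝ) 1) (hva : Antitone v) (hvs : ¬ Summable v)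
    {l : ℕ → ℝ} (hl : ∀ n, l n ∈ Icc (0 : ℝ) 1) {L : ℕ → ℕ} {C : ℝ}
    (hC : ∀ n, L n * l n ≤ C) (M : ℕ) :
    P {ω | ∀ n, M ≤ n → (ε n ω).1 < chain a ξ ε n ω → (ε n ω).2 ≤ v n →
      ∃ j ∈ Finset.Ioc n (n + L n), (ε j ω).1 < l n} ≤ ENNReal.ofReal C := by
  set A : ℕ → Set Ω := fun n => {ω | M ≤ n ∧ (ε n ω).1 < chain a ξ ε n ω ∧ (ε n ω).2 ≤ v n} with hA
  set F : ℕ → Set Ω := fun n => {ω | ∃ j ∈ Finset.Ioc n (n + L n), (ε j ω).1 < l n} with hF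
  have hAm : ∀ {k n : ℕ}, k < n → MeasurableSet[chainPast ξ ε n] (A k) := by
    intro k n hkn
    have h1 := measurable_innov_chainPast (ξ := ξ) (ε := ε) hkn
    have h2 := measurable_chain_chainPast (ξ := ξ) (ε := ε) ha hkn.le
    have e : A k = {_ω : Ω | M ≤ k} ∩ ({ω | (ε k ω).1 < chain a ξ ε k ω} ∩
        {ω | (ε k ω).2 ≤ v k}) := by
      ext ω; simp [hA]
    rw [e]
    refine MeasurableSet.inter (MeasurableSet.const _) (MeasurableSet.inter ?_ ?_)
    · exact ((measurable_fst.comp h1).prodMk h2) measurableSet_lt'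
    · exact (measurable_snd.comp h1) measurableSet_Iic
  -- `B n` is the event that the first such jump occurs at time `n`
  set B := disjointed A with hB
  have hBm : ∀ n, MeasurableSet[chainPast ξ ε (n + 1)] (B n) := by
    intro n
    rw [hB, disjointed_eq_inter_compl]
    refine MeasurableSet.inter (hAm n.lt_succ_self) ?_
    exact MeasurableSet.iInter fun j => MeasurableSet.iInter fun hj => (hAm (by omega)).compl
  have hFm : ∀ n, MeasurableSet[MeasurableSpace.comap
      (fun ω (j : Finset.Ioc n (n + L n)) => ε j ω) inferInstance] (F n) := by
    intro n
    refine ⟨{x | ∃ j : Finset.Ioc n (n + L n), (x j).1 < l n}, ?_, ?_⟩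
    · have : {x : Finset.Ioc n (n + L n) → ℝ × ℝ | ∃ j : Finset.Ioc n (n + L n), (x j).1 < l n}
          = ⋃ j, {x | (x j).1 < l n} := by ext x; simp
      rw [this]
      exact MeasurableSet.iUnion fun j => measurableSet_lt (by fun_prop) measurable_const
    · ext ω
      simp [hF]
  have hind : ∀ n, P (B n ∩ F n) = P (B n) * P (F n) := fun n =>
    (Indep_iff _ _ _).1 (indep_chainPast h (n := n + 1) (T := Finset.Ioc n (n + L n))
      fun j hj => (Finset.mem_Ioc.1 hj).1) _ _ (hBm n) (hFm n)
  have hPF : ∀ n, P (F n) ≤ ENNReal.ofReal C := fun n =>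
    (measure_exists_innov_fst_lt_le h _ (hl n)).trans
      (ENNReal.ofReal_le_ofReal (by simpa using hC n))
  have hcov : ∀ᵐ ω ∂P, ω ∈ ⋃ n, B n := by
    filter_upwards [ae_exists_low_jump ha h hv hva hvs M] with ω ⟨n, hn, h1, h2⟩
    rw [hB, iUnion_disjointed]
    exact mem_iUnion.2 ⟨n, hn, h1, h2⟩
  have hBmeas : ∀ n, MeasurableSet (B n) := fun n => chainPast_le h _ _ (hBm n)
  calc _ ≤ P (⋃ n, B n ∩ F n) := by
        refine measure_mono_ae ?_
        filter_upwards [hcov] with ω hω hall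
        obtain ⟨n, hn⟩ := mem_iUnion.1 hω
        obtain ⟨h0, h1, h2⟩ := disjointed_subset A n hn
        exact mem_iUnion.2 ⟨n, hn, hall n h0 h1 h2⟩
    _ ≤ ∑' n, P (B n ∩ F n) := measure_iUnion_le _
    _ ≤ ∑' n, P (B n) * ENNReal.ofReal C := by
        refine ENNReal.tsum_le_tsum fun n => ?_
        rw [hind n]
        gcongr
        exact hPF n
    _ = P (⋃ n, B n) * ENNReal.ofReal C := by
        rw [ENNReal.tsum_mul_right, measure_iUnion (disjoint_disjointed A) hBmeas]
    _ ≤ ENNReal.ofReal C := mul_le_of_le_one_left' prob_le_one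

omit [MeasurableSpace Ω] in
theorem chain_eq_of_forall_le {n L : ℕ} {x : ℝ} {ω : Ω} (hx : chain a ξ ε n ω ≤ x)
    (hU : ∀ j, n ≤ j → j < n + L → x ≤ (ε j ω).1) {i : ℕ} (h1 : n ≤ i) (h2 : i ≤ n + L) :
    chain a ξ ε i ω = chain a ξ ε n ω := by
  induction i, h1 using Nat.le_induction with
  | base => rfl
  | succ i h1 ih =>
    have hi := ih (by omega)
    have : chain a ξ ε (i + 1) ω = chainStep a (ε i ω) (chain a ξ ε i ω) := rfl
    rw [this, chainStep, if_pos, hi]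
    rw [hi]
    exact hx.trans (hU i h1 (by omega))

/-- Almost surely, for some scale `1 / (m + 1)`, the chain stays infinitely often at one point below
`l n` for the whole block `(n, n + L m n]`. -/
theorem ae_exists_frequently_hold (ha : 0 < a) (h : IsChainInput P a ξ ε)
    {v : ℕ → ℝ} (hv : ∀ n, v n ∈ Icc (0 : ℝ) 1) (hva : Antitone v) (hvs : ¬ Summable v)
    {L : ℕ → ℕ → ℕ} (hL : ∀ m n, ((L m n : ℝ) - 1) * v n ^ (a + 1)⁻¹ ≤ 1 / (m + 1)) :
    ∀ᵐ ω ∂P, ∃ m : ℕ, ∃ᶠ n in atTop, ∃ w, w ∈ Icc 0 (v n ^ (a + 1)⁻¹) ∧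
      ∀ i ∈ Finset.Ioc n (n + L m n), chain a ξ ε i ω = w := by
  have hl : ∀ n, v n ^ (a + 1)⁻¹ ∈ Icc (0 : ℝ) 1 := fun n =>
    ⟨Real.rpow_nonneg (hv n).1 _, Real.rpow_le_one (hv n).1 (hv n).2 (by positivity)⟩
  -- the jump at `n` determines the value at `n + 1`;
  -- holding it up to `n + L m n` takes `L m n - 1` steps
  set bad : ℕ → ℕ → Set Ω := fun m M => {ω | ∀ n, M ≤ n → (ε n ω).1 < chain a ξ ε n ω →
    (ε n ω).2 ≤ v n → ∃ j ∈ Finset.Ioc n (n + (L m n - 1)), (ε j ω).1 < v n ^ (a + 1)⁻¹} with hbad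
  have hbad_le : ∀ m M, P (bad m M) ≤ ENNReal.ofReal (1 / (m + 1)) := by
    intro m M
    refine measure_no_long_hold_le ha h hv hva hvs hl (L := fun n => L m n - 1) (fun n => ?_) M
    rcases Nat.eq_zero_or_pos (L m n) with h0 | h0
    · rw [h0]; simp; positivity
    · rw [Nat.cast_sub h0, Nat.cast_one]
      exact hL m n
  have hmono : ∀ m, Monotone (bad m) := fun m M M' hMM ω hω n hn => hω n (hMM.trans hn)
  have hU : ∀ m, P (⋃ M, bad m M) ≤ ENNReal.ofReal (1 / (m + 1)) := fun m => by
    rw [(hmono m).measure_iUnion]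
    exact iSup_le (hbad_le m)
  have hnull : P (⋂ m, ⋃ M, bad m M) = 0 := by
    have hlim : Tendsto (fun m : ℕ => ENNReal.ofReal (1 / ((m : ℝ) + 1))) atTop (𝓝 0) := by
      simpa using ENNReal.tendsto_ofReal tendsto_one_div_add_atTop_nhds_zero_nat
    exact le_antisymm (ge_of_tendsto' hlim fun m =>
      (measure_mono (iInter_subset _ m)).trans (hU m)) zero_le
  filter_upwards [measure_eq_zero_iff_ae_notMem.1 hnull, ae_all_iff.2 (ae_innov_mem_Icc h)]
    with ω hω hunit
  simp only [mem_iInter, mem_iUnion, not_forall, not_exists] at hω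
  obtain ⟨m, hm⟩ := hω
  refine ⟨m, frequently_atTop.2 fun M => ?_⟩
  have hM := hm M
  simp only [hbad, mem_ofPred_eq, not_forall] at hM
  obtain ⟨n, hn, h1, h2, h3⟩ := hM
  push Not at h3
  have hW : chain a ξ ε (n + 1) ω = (ε n ω).2 ^ (a + 1)⁻¹ := by
    have : chain a ξ ε (n + 1) ω = chainStep a (ε n ω) (chain a ξ ε n ω) := rfl
    rw [this, chainStep, if_neg (not_le.2 h1), piQuantile_of_mem ha (hunit n).2]
  have hWl : chain a ξ ε (n + 1) ω ≤ v n ^ (a + 1)⁻¹ := by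
    rw [hW]
    exact Real.rpow_le_rpow (hunit n).2.1 h2 (by positivity)
  refine ⟨n, hn, chain a ξ ε (n + 1) ω, ⟨?_, hWl⟩, fun i hi => ?_⟩
  · rw [hW]
    exact Real.rpow_nonneg (hunit n).2.1 _
  · rw [Finset.mem_Ioc] at hi
    refine chain_eq_of_forall_le (L := L m n - 1) hWl (fun j hj1 hj2 => ?_) (by omega) (by omega)
    exact h3 j (Finset.mem_Ioc.2 ⟨by omega, by omega⟩)

end Chain

/-! ### The meeting time -/

section Meeting

variable {Ω : Type*} {ξ : Ω → ℝ} {ε : ℕ → Ω → ℝ × ℝ} {a : ℝ} [MeasurableSpace Ω] {P : Measure Ω}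
  [IsProbabilityMeasure P]

/-- A chain driven by the same innovations but started from `ξ'` almost surely never visits the
point `ξ`: it only takes the values `ξ'` and `F_π⁻¹(V_k)`, which are independent of `ξ`. -/
theorem ae_forall_chain_ne_init (ha : 0 < a) (h : IsChainInput P a ξ ε) {ξ' : Ω → ℝ}
    (hξ' : Measurable ξ') (hlaw : P.map ξ' = nuLaw a)
    (hind : IndepFun ξ' (fun ω => (ξ ω, fun k => ε k ω)) P) :
    ∀ᵐ ω ∂P, ∀ k, chain a ξ' ε k ω ≠ ξ ω := by
  have h0 : ∀ᵐ ω ∂P, ξ' ω ≠ ξ ω := by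
    refine ae_ne_of_indepFun_of_singleton_null hξ' h.measurable_init
      (hind.comp measurable_id measurable_fst) fun x => ?_
    rw [hlaw, nuLaw_singleton]
  have h1 : ∀ k, ∀ᵐ ω ∂P, ξ ω ≠ piQuantile a (ε k ω).2 := by
    intro k
    have hm : Measurable fun x : ℕ → ℝ × ℝ => piQuantile a (x k).2 :=
      (measurable_piQuantile ha).comp (by fun_prop)
    refine ae_ne_of_indepFun_of_singleton_null h.measurable_init
      ((measurable_piQuantile ha).comp (measurable_snd.comp (h.measurable_innov k)))
      (h.indep_init.comp measurable_id hm) fun x => ?_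
    rw [h.law_init, nuLaw_singleton]
  filter_upwards [h0, ae_all_iff.2 h1] with ω hω0 hω1 k
  induction k with
  | zero => exact hω0
  | succ k ih =>
    change chainStep a (ε k ω) (chain a ξ' ε k ω) ≠ ξ ω
    unfold chainStep
    split_ifs
    · exact ih
    · exact (hω1 k).symm

/-- The chain cannot meet the other one while it stays at its initial point, which it does up to
time `N` with probability at least `1 / 2` when that point is below `1 / (2 * N)`. -/
theorem le_measure_meetingTime (ha : 0 < a) (h : IsChainInput P a ξ ε) {ξ' : Ω → ℝ}
    (hξ' : Measurable ξ') (hlaw : P.map ξ' = nuLaw a)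
    (hind : IndepFun ξ' (fun ω => (ξ ω, fun k => ε k ω)) P) {N : ℕ} (hN : 0 < N) :
    ENNReal.ofReal ((1 / (2 * N)) ^ a * (1 / 2)) ≤
      P {ω | (N : ℕ∞) ≤ meetingTime (chain a ξ ε) (chain a ξ' ε) ω} := by
  have hN1 : (1 : ℝ) ≤ N := by exact_mod_cast hN
  set x : ℝ := 1 / (2 * N) with hx
  have hxI : x ∈ Icc (0 : ℝ) 1 := by
    refine ⟨by positivity, ?_⟩
    rw [hx, div_le_one (by positivity)]
    linarith
  set T := Finset.range N
  set F : Set Ω := {ω | ∃ j ∈ T, (ε j ω).1 < x} with hF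
  have hFm : MeasurableSet[MeasurableSpace.comap (fun ω (j : T) => ε j ω) inferInstance] F := by
    refine ⟨{y | ∃ j : T, (y j).1 < x}, ?_, ?_⟩
    · have : {y : T → ℝ × ℝ | ∃ j : T, (y j).1 < x} = ⋃ j, {y | (y j).1 < x} := by ext y; simp
      rw [this]
      exact MeasurableSet.iUnion fun j => measurableSet_lt (by fun_prop) measurable_const
    · ext ω
      simp [hF]
  have hFm' : MeasurableSet F := by
    refine (measurable_pi_iff.2 fun j : T => h.measurable_innov j).comap_le F hFm
  have hIm : MeasurableSet[chainPast ξ ε 0] {ω | ξ ω ≤ x} :=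
    measurable_init_chainPast 0 measurableSet_Iic
  have hPF : P F ≤ ENNReal.ofReal (1 / 2) := by
    refine (measure_exists_innov_fst_lt_le h T hxI).trans_eq ?_
    congr 1
    rw [Finset.card_range, hx]
    field_simp
  have hPFc : ENNReal.ofReal (1 / 2) ≤ P Fᶜ := by
    rw [prob_compl_eq_one_sub hFm']
    refine le_trans ?_ (tsub_le_tsub_left hPF 1)
    rw [← ENNReal.ofReal_one, ← ENNReal.ofReal_sub _ (by norm_num)]
    norm_num
  have hPξ : P {ω | ξ ω ≤ x} = ENNReal.ofReal (x ^ a) := by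
    rw [← nuLaw_Iic ha hxI, ← h.law_init, Measure.map_apply h.measurable_init measurableSet_Iic]
    rfl
  have hindep : P ({ω | ξ ω ≤ x} ∩ Fᶜ) = P {ω | ξ ω ≤ x} * P Fᶜ :=
    (Indep_iff _ _ _).1 (indep_chainPast h (n := 0) (T := T) fun j _ => j.zero_le) _ _ hIm hFm.compl
  calc _ = ENNReal.ofReal (x ^ a) * ENNReal.ofReal (1 / 2) :=
        ENNReal.ofReal_mul (Real.rpow_nonneg hxI.1 _)
    _ ≤ P ({ω | ξ ω ≤ x} ∩ Fᶜ) := by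
        rw [hindep, hPξ]
        gcongr
    _ ≤ _ := by
        refine measure_mono_ae ?_
        filter_upwards [ae_forall_chain_ne_init ha h hξ' hlaw hind] with ω hne hω
        obtain ⟨h1, h2⟩ := hω
        refine le_iInf₂ fun k hk => ?_
        by_contra hlt
        have hkN : k < N := by exact_mod_cast not_le.1 hlt
        have hW : chain a ξ ε k ω = ξ ω := by
          refine chain_eq_of_forall_le (n := 0) (L := N) (x := x) h1 (fun j _ hj => ?_)
            k.zero_le (by omega)
          by_contra hj2
          exact h2 ⟨j, Finset.mem_range.2 (by omega), not_le.1 hj2⟩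
        exact hne k (hk.symm.trans hW)

/-- The tails of the meeting time are at least of order `n ^ (1 - p)`, so the series dominates the
harmonic one. -/
theorem not_tailSumFinite_meetingTime {p : ℝ} (hp : 1 < p) (h : IsChainInput P (p - 1) ξ ε)
    {ξ' : Ω → ℝ} (hξ' : Measurable ξ') (hlaw : P.map ξ' = nuLaw (p - 1))
    (hind : IndepFun ξ' (fun ω => (ξ ω, fun k => ε k ω)) P) :
    ¬ TailSumFinite P p (meetingTime (chain (p - 1) ξ ε) (chain (p - 1) ξ' ε)) := by
  intro hfin
  have ha : 0 < p - 1 := by linarith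
  have hterm : ∀ n : ℕ, ENNReal.ofReal (2⁻¹ ^ p * (1 / ((n : ℝ) + 1))) ≤
      ENNReal.ofReal (((n + 1 : ℕ) : ℝ) ^ (p - 2)) *
        P {ω | ((n + 1 : ℕ) : ℕ∞) ≤ meetingTime (chain (p - 1) ξ ε) (chain (p - 1) ξ' ε) ω} := by
    intro n
    refine le_trans (le_of_eq ?_)
      (mul_le_mul_right (le_measure_meetingTime ha h hξ' hlaw hind n.succ_pos) _)
    rw [← ENNReal.ofReal_mul (by positivity)]
    congr 1
    have hn : (0 : ℝ) < (n : ℝ) + 1 := by positivity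
    push_cast
    rw [show p - 2 = p - 1 - 1 by ring, Real.rpow_sub_one hn.ne', one_div (2 * _), mul_inv,
      Real.mul_rpow (by norm_num) (by positivity), Real.inv_rpow hn.le,
      Real.rpow_sub_one (by norm_num : (2⁻¹ : ℝ) ≠ 0)]
    have := (Real.rpow_pos_of_pos hn (p - 1)).ne'
    field_simp
  have hlt := (ENNReal.tsum_le_tsum hterm).trans_lt hfin
  have hs := ENNReal.summable_toReal hlt.ne
  have hs2 : Summable fun n : ℕ => 2⁻¹ ^ p * (1 / ((n : ℝ) + 1)) := by
    refine hs.congr fun n => ?_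
    rw [ENNReal.toReal_ofReal (by positivity)]
  have hs3 := (summable_mul_left_iff (by positivity)).1 hs2
  refine Real.not_summable_one_div_natCast ((summable_nat_add_iff 1).1 ?_)
  simpa using hs3

end Meeting

/-! ### Block sums of stationary Gaussian sequences -/

section Gaussian

variable {Ω : Type*} [MeasurableSpace Ω] {P : Measure Ω} [IsProbabilityMeasure P] {g : ℤ → Ω → ℝ}

omit [IsProbabilityMeasure P] in
theorem IsStationaryGaussian.memLp_two (hg : IsStationaryGaussian P g) (k : ℤ) : MemLp (g k) 2 P :=
  (hg.gaussian.hasGaussianLaw_eval k).memLp_two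

omit [IsProbabilityMeasure P] in
theorem IsStationaryGaussian.covariance_add (hg : IsStationaryGaussian P g) (i k : ℤ) :
    cov[g i, g (k + i); P] = cov[g 0, g k; P] := by
  have hm : Measurable fun x : ℤ → ℝ => x 0 * x k := by fun_prop
  have h1 := ((hg.stationary i).comp hm).integral_eq
  simp only [Function.comp_def, zero_add] at h1
  simp only [covariance, hg.centered, sub_zero]
  exact h1

/-- Partial sums of a bounded covariance series give block variances of linear order. -/
theorem IsStationaryGaussian.exists_variance_block_le (hg : IsStationaryGaussian P g) :
    ∃ D : ℝ, 0 < D ∧ ∀ n L : ℕ,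
      Var[fun ω => ∑ i ∈ Finset.Ioc n (n + L), g (i : ℤ) ω; P] ≤ D * L := by
  obtain ⟨s, hs⟩ := hg.cov_series
  obtain ⟨B, hB⟩ := hs.bddAbove_range
  have hB' : ∀ n, ∑ k ∈ Finset.range n, cov[g 0, g (k : ℤ); P] ≤ B := fun n => hB ⟨n, rfl⟩
  have hc0 : 0 ≤ cov[g 0, g 0; P] := by
    rw [covariance_self (hg.gaussian.aemeasurable 0)]; exact variance_nonneg _ _
  refine ⟨2 * |B| + 1, by positivity, fun n L => ?_⟩
  induction L with
  | zero =>
    simp only [Nat.add_zero, Finset.Ioc_self, Finset.sum_empty, Nat.cast_zero, mul_zero]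
    exact (variance_zero P).le
  | succ L ih =>
    have hL : n + (L + 1) = (n + L) + 1 := by ring
    have hsum : (fun ω => ∑ i ∈ Finset.Ioc n (n + (L + 1)), g (i : ℤ) ω) =
        (fun ω => ∑ i ∈ Finset.Ioc n (n + L), g (i : ℤ) ω) + g ((n + L + 1 : ℕ) : ℤ) := by
      ext ω
      rw [hL, Finset.sum_Ioc_succ_top (by omega), Pi.add_apply]
    have hm : MemLp (fun ω => ∑ i ∈ Finset.Ioc n (n + L), g (i : ℤ) ω) 2 P :=
      memLp_finsetSum _ fun i _ => hg.memLp_two i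
    have hcov : cov[fun ω => ∑ i ∈ Finset.Ioc n (n + L), g (i : ℤ) ω, g ((n + L + 1 : ℕ) : ℤ); P]
        = ∑ k ∈ Finset.range (L + 1), cov[g 0, g (k : ℤ); P] - cov[g 0, g 0; P] := by
      rw [covariance_fun_sum_left' (X := fun i : ℕ => g (i : ℤ)) (fun i _ => hg.memLp_two i)
          (hg.memLp_two _),
        Finset.sum_range_succ']
      simp only [Nat.cast_zero, add_sub_cancel_right]
      refine Finset.sum_nbij' (fun i => n + L - i) (fun k => n + L - k) ?_ ?_ ?_ ?_ ?_
      · intro i hi; rw [Finset.mem_Ioc] at hi; rw [Finset.mem_range]; omega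
      · intro k hk; rw [Finset.mem_range] at hk; rw [Finset.mem_Ioc]; omega
      · intro i hi; rw [Finset.mem_Ioc] at hi; omega
      · intro k hk; rw [Finset.mem_range] at hk; omega
      · intro i hi
        rw [Finset.mem_Ioc] at hi
        rw [← hg.covariance_add (i : ℤ) ((n + L - i + 1 : ℕ) : ℤ)]
        congr 2
        omega
    have hvar : Var[g ((n + L + 1 : ℕ) : ℤ); P] = cov[g 0, g 0; P] := by
      rw [← covariance_self (hg.gaussian.aemeasurable _)]
      have := hg.covariance_add ((n + L + 1 : ℕ) : ℤ) 0
      rwa [zero_add] at this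
    rw [hsum, variance_add hm (hg.memLp_two _), hcov, hvar]
    have := hB' (L + 1)
    have := le_abs_self B
    push_cast
    nlinarith

/-- The Gaussian tail bound, with `s` any upper bound of the variance. -/
theorem measureReal_abs_ge_le_of_hasGaussianLaw {X : Ω → ℝ} (hX : HasGaussianLaw X P)
    (h0 : ∫ ω, X ω ∂P = 0) {s t : ℝ} (hs : 0 ≤ s) (hvar : Var[X; P] ≤ s) (ht : 0 ≤ t) :
    P.real {ω | t ≤ |X ω|} ≤ 2 * Real.exp (-t ^ 2 / (2 * s)) := by
  have hmap := hX.map_eq_gaussianReal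
  rw [h0] at hmap
  have hsub : HasSubgaussianMGF X s.toNNReal P := by
    refine ⟨fun r => ?_, fun r => ?_⟩
    · have := integrable_exp_mul_gaussianReal (μ := 0) (v := Var[X; P].toNNReal) r
      rw [← hmap] at this
      exact (integrable_map_measure (by fun_prop) hX.aemeasurable).1 this
    · rw [mgf_gaussianReal hmap, Real.coe_toNNReal _ hs, Real.coe_toNNReal _ (variance_nonneg _ _)]
      refine Real.exp_le_exp.2 ?_
      nlinarith [sq_nonneg r]
  have h1 := hsub.measure_ge_le ht
  have h2 := hsub.neg.measure_ge_le ht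
  rw [Real.coe_toNNReal _ hs] at h1 h2
  have hsub : {ω | t ≤ |X ω|} ⊆ {ω | t ≤ X ω} ∪ {ω | t ≤ (-X) ω} := fun ω hω => by
    simpa only [mem_union, mem_ofPred_eq, Pi.neg_apply] using le_abs.1 (mem_ofPred_eq.mp hω)
  calc _ ≤ _ := (measureReal_mono hsub).trans (measureReal_union_le _ _)
    _ ≤ _ := by linarith

theorem summable_exp_neg_mul_rpow {c q : ℝ} (hc : 0 < c) (hq : 0 < q) :
    Summable fun n : ℕ => Real.exp (-c * (n : ℝ) ^ q) := by
  have h1 := isLittleO_exp_neg_mul_rpow_atTop hc (-2 / q)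
  have h2 : Tendsto (fun n : ℕ => (n : ℝ) ^ q) atTop atTop :=
    (tendsto_rpow_atTop hq).comp tendsto_natCast_atTop_atTop
  have h3 := (h1.comp_tendsto h2).isBigO
  refine summable_of_isBigO_nat (Real.summable_nat_rpow.2 (by norm_num : (-2 : ℝ) < -1)) ?_
  refine h3.congr_right fun n => ?_
  simp only [Function.comp_apply]
  rw [← Real.rpow_mul (by positivity)]
  congr 1
  field_simp

/-- Blocks of length `L n ≥ c n ^ q` of a stationary Gaussian sequence have sums of smaller order
than `L n`; no independence between the sequence and anything else is involved. -/
theorem IsStationaryGaussian.ae_eventually_abs_block_le (hg : IsStationaryGaussian P g)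
    {c q δ : ℝ} (hc : 0 < c) (hq : 0 < q) (hδ : 0 < δ) {L : ℕ → ℕ}
    (hL : ∀ n : ℕ, c * (n : ℝ) ^ q ≤ L n) :
    ∀ᵐ ω ∂P, ∀ᶠ n : ℕ in atTop, |∑ i ∈ Finset.Ioc n (n + L n), g (i : ℤ) ω| ≤ δ * L n := by
  obtain ⟨D, hD, hvar⟩ := hg.exists_variance_block_le
  set c' := δ ^ 2 * c / (2 * D) with hc'
  have hc'pos : 0 < c' := by positivity
  have hbound : ∀ n : ℕ, P {ω | δ * L n ≤ |∑ i ∈ Finset.Ioc n (n + L n), g (i : ℤ) ω|} ≤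
      ENNReal.ofReal (2 * Real.exp (-c' * (n : ℝ) ^ q)) := by
    intro n
    have hlaw : HasGaussianLaw (fun ω => ∑ i ∈ Finset.Ioc n (n + L n), g (i : ℤ) ω) P :=
      (hg.gaussian.comp_right (fun i : ℕ => (i : ℤ))).hasGaussianLaw_fun_sum
    have hmean : ∫ ω, ∑ i ∈ Finset.Ioc n (n + L n), g (i : ℤ) ω ∂P = 0 := by
      rw [integral_finsetSum (f := fun (i : ℕ) ω => g (i : ℤ) ω) _ fun i _ =>
          (hg.memLp_two i).integrable (by norm_num)]
      simp [hg.centered]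
    have h1 := measureReal_abs_ge_le_of_hasGaussianLaw hlaw hmean
      (by positivity : (0 : ℝ) ≤ D * L n) (hvar n (L n)) (by positivity : (0 : ℝ) ≤ δ * L n)
    rw [← ofReal_measureReal]
    refine ENNReal.ofReal_le_ofReal (h1.trans ?_)
    refine mul_le_mul_of_nonneg_left (Real.exp_le_exp.2 ?_) (by norm_num)
    have h2 : -(δ * (L n : ℝ)) ^ 2 / (2 * (D * L n)) = -(δ ^ 2 / (2 * D)) * L n := by
      rcases eq_or_ne (L n : ℝ) 0 with h0 | h0
      · rw [h0]; simp
      · field_simp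
    have h3 : -c' * (n : ℝ) ^ q = -(δ ^ 2 / (2 * D)) * (c * (n : ℝ) ^ q) := by
      rw [hc']; ring
    rw [h2, h3, neg_mul, neg_mul, neg_le_neg_iff]
    exact mul_le_mul_of_nonneg_left (hL n) (by positivity)
  have hsum : ∑' n : ℕ, P {ω | δ * L n ≤ |∑ i ∈ Finset.Ioc n (n + L n), g (i : ℤ) ω|} ≠ ∞ := by
    refine ne_top_of_le_ne_top ?_ (ENNReal.tsum_le_tsum hbound)
    exact ((summable_exp_neg_mul_rpow hc'pos hq).mul_left 2).tsum_ofReal_ne_top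
  filter_upwards [ae_eventually_notMem hsum] with ω hω
  filter_upwards [hω] with n hn
  exact (not_le.1 hn).le

end Gaussian

/-! ### The normalising sequence and the lower bound -/

/-- The sequence `n log n`, made at least `1` and monotone by stopping it below `n = 3`. -/
noncomputable def nLog (n : ℕ) : ℝ := (max n 3 : ℕ) * Real.log (max n 3 : ℕ)

theorem one_le_log_max_three (n : ℕ) : 1 ≤ Real.log (max n 3 : ℕ) := by
  rw [Real.le_log_iff_exp_le (by positivity)]
  have h3 : (3 : ℝ) ≤ (max n 3 : ℕ) := by exact_mod_cast le_max_right n 3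
  linarith [Real.exp_one_lt_d9]

theorem nLog_mono : Monotone nLog := by
  intro m n hmn
  have h1 : ((max m 3 : ℕ) : ℝ) ≤ (max n 3 : ℕ) := by exact_mod_cast max_le_max_right 3 hmn
  have h2 : (0 : ℝ) < (max m 3 : ℕ) := by positivity
  have := one_le_log_max_three m
  exact mul_le_mul h1 (Real.log_le_log h2 h1) (by linarith) (by positivity)

theorem natCast_le_nLog (n : ℕ) : (n : ℝ) ≤ nLog n := by
  have h1 : (n : ℝ) ≤ (max n 3 : ℕ) := by exact_mod_cast le_max_left n 3
  exact h1.trans (le_mul_of_one_le_right (by positivity) (one_le_log_max_three n))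

theorem one_le_nLog (n : ℕ) : 1 ≤ nLog n := by
  have h1 : (1 : ℝ) ≤ (max n 3 : ℕ) := by
    exact_mod_cast (by norm_num : 1 ≤ 3).trans (le_max_right n 3)
  exact h1.trans (le_mul_of_one_le_right (by positivity) (one_le_log_max_three n))

theorem nLog_of_three_le {n : ℕ} (hn : 3 ≤ n) : nLog n = n * Real.log n := by
  rw [nLog, max_eq_left hn]

theorem nLog_le_sq {n : ℕ} (hn : 3 ≤ n) : nLog n ≤ (n : ℝ) ^ 2 := by
  rw [nLog_of_three_le hn, pow_two]
  exact mul_le_mul_of_nonneg_left (Real.log_le_self (by positivity)) (by positivity)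

theorem nLog_le_six_mul {n k : ℕ} (hn : 3 ≤ n) (hk : k ≤ 3 * n) : nLog k ≤ 6 * nLog n := by
  refine (nLog_mono hk).trans ?_
  rw [nLog_of_three_le hn, nLog_of_three_le (by omega)]
  have hn0 : (0 : ℝ) < n := by positivity
  have h3 : (3 : ℝ) ≤ n := by exact_mod_cast hn
  push_cast
  rw [Real.log_mul (by norm_num) hn0.ne']
  have := Real.log_le_log (by norm_num) h3
  nlinarith

/-- The series `∑ 1 / (n log n)` diverges, by Cauchy condensation. -/
theorem not_summable_inv_nLog : ¬ Summable fun n => (nLog n)⁻¹ := by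
  intro hs
  have h1 := (summable_condensed_iff_of_nonneg (f := fun n => (nLog n)⁻¹)
    (fun n => inv_nonneg.2 (zero_le_one.trans (one_le_nLog n)))
    (fun m n _ hmn => inv_anti₀ (zero_lt_one.trans_le (one_le_nLog m)) (nLog_mono hmn))).2 hs
  have h2 := (summable_nat_add_iff 2).2 h1
  have hlog : 0 < Real.log 2 := Real.log_pos (by norm_num)
  have h3 : Summable fun k : ℕ => (Real.log 2)⁻¹ * (1 / ((k + 2 : ℕ) : ℝ)) := by
    refine h2.congr fun k => ?_
    have h4 : 3 ≤ 2 ^ (k + 2) := by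
      have := Nat.one_le_two_pow (n := k)
      rw [pow_add]; omega
    have h5 : (0 : ℝ) < ((k + 2 : ℕ) : ℝ) := by positivity
    rw [nLog_of_three_le h4]
    push_cast
    rw [Real.log_pow]
    push_cast at h5 ⊢
    field_simp
  exact Real.not_summable_one_div_natCast
    ((summable_nat_add_iff 2).1 ((summable_mul_left_iff (by positivity)).1 h3))

theorem left_lt_integral_of_deriv_pos {f f' : ℝ → ℝ}
    (hf : ∀ x ∈ Icc (0 : ℝ) 1, HasDerivWithinAt f (f' x) (Icc (0 : ℝ) 1) x)
    (hpos : ∀ x ∈ Icc (0 : ℝ) 1, 0 < f' x) : f 0 < ∫ t in (0 : ℝ)..1, f t := by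
  have hc : ContinuousOn f (Icc 0 1) := fun x hx => (hf x hx).continuousWithinAt
  have hmono : StrictMonoOn f (Icc 0 1) := by
    refine strictMonoOn_of_deriv_pos (convex_Icc 0 1) hc fun x hx => ?_
    have hx' := interior_subset hx
    rw [((hf x hx').hasDerivAt (mem_interior_iff_mem_nhds.1 hx)).deriv]
    exact hpos x hx'
  have h0 : (0 : ℝ) ∈ Icc (0 : ℝ) 1 := by simp
  have h1 : (1 : ℝ) ∈ Icc (0 : ℝ) 1 := by simp
  have := intervalIntegral.integral_lt_integral_of_continuousOn_of_le_of_exists_lt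
    (zero_lt_one' ℝ) (continuousOn_const (c := f 0)) hc
    (fun x hx => hmono.monotoneOn h0 ⟨hx.1.le, hx.2⟩ hx.1.le) ⟨1, h1, hmono h0 h1 zero_lt_one⟩
  simpa using this

/-- A deviation by `δ L n` over blocks `(n, n + L n]` with `L n` of order at least
`(n log n) ^ (1 / p)` rules out an error of smaller order than `(n log n) ^ (1 / p)`. -/
theorem zero_lt_limsup_of_frequently_block {p c δ : ℝ} (hp : 2 ≤ p) (hc : 0 < c) (hδ : 0 < δ)
    {X : ℕ → ℝ} {L : ℕ → ℕ} (hcL : ∀ n, c * nLog n ^ (1 / p) ≤ L n)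
    (hLc : ∀ n, (L n : ℝ) ≤ nLog n ^ (1 / p) + 1)
    (hX : ∃ᶠ n in atTop, δ * L n ≤ |X (n + L n) - X n|) :
    (0 : EReal) < limsup (fun n : ℕ =>
      ((((n : ℝ) * Real.log n) ^ (-(1 / p)) * |X n| : ℝ) : EReal)) atTop := by
  have hp0 : 0 < p := by linarith
  have hq : 0 < 1 / p := by positivity
  by_contra hcon
  set η : ℝ := δ * c / 8 with hη
  have hηpos : 0 < η := by positivity
  have hlt : limsup (fun n : ℕ =>
      ((((n : ℝ) * Real.log n) ^ (-(1 / p)) * |X n| : ℝ) : EReal)) atTop < (η : EReal) :=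
    (not_lt.1 hcon).trans_lt (by exact_mod_cast hηpos)
  have hev : ∀ᶠ n : ℕ in atTop, |X n| ≤ η * nLog n ^ (1 / p) := by
    filter_upwards [eventually_lt_of_limsup_lt hlt, eventually_ge_atTop 3] with n hn hn3
    have hn' : ((n : ℝ) * Real.log n) ^ (-(1 / p)) * |X n| < η := by exact_mod_cast hn
    have hpos : 0 < nLog n := zero_lt_one.trans_le (one_le_nLog n)
    rw [← nLog_of_three_le hn3, Real.rpow_neg hpos.le, inv_mul_eq_div,
      div_lt_iff₀ (Real.rpow_pos_of_pos hpos _)] at hn'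
    exact hn'.le
  obtain ⟨N, hN⟩ := eventually_atTop.1 hev
  obtain ⟨n, hn, hdev⟩ := frequently_atTop.1 hX (max N 3)
  have hn3 : 3 ≤ n := (le_max_right N 3).trans hn
  have hnN : N ≤ n := (le_max_left N 3).trans hn
  have hpos : 0 < nLog n := zero_lt_one.trans_le (one_le_nLog n)
  have hb : 0 < nLog n ^ (1 / p) := Real.rpow_pos_of_pos hpos _
  have hbn : nLog n ^ (1 / p) ≤ n := by
    have h1 : (1 : ℝ) ≤ n := by exact_mod_cast (by omega : 1 ≤ n)
    calc nLog n ^ (1 / p) ≤ ((n : ℝ) ^ 2) ^ (1 / p) :=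
          Real.rpow_le_rpow hpos.le (nLog_le_sq hn3) hq.le
      _ = (n : ℝ) ^ (2 / p) := by
          rw [← Real.rpow_natCast, ← Real.rpow_mul (by positivity)]
          congr 1
          push_cast
          ring
      _ ≤ (n : ℝ) ^ (1 : ℝ) :=
          Real.rpow_le_rpow_of_exponent_le h1 ((div_le_one hp0).2 hp)
      _ = n := Real.rpow_one _
  have hLn : n + L n ≤ 3 * n := by
    have h1 : ((L n : ℕ) : ℝ) ≤ ((n + 1 : ℕ) : ℝ) := by
      push_cast
      linarith [hLc n]
    have h2 : L n ≤ n + 1 := by exact_mod_cast h1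
    omega
  have h6 : nLog (n + L n) ^ (1 / p) ≤ 6 * nLog n ^ (1 / p) := by
    have hpos' : 0 < nLog (n + L n) := zero_lt_one.trans_le (one_le_nLog _)
    calc nLog (n + L n) ^ (1 / p) ≤ (6 * nLog n) ^ (1 / p) :=
          Real.rpow_le_rpow hpos'.le (nLog_le_six_mul hn3 hLn) hq.le
      _ = 6 ^ (1 / p) * nLog n ^ (1 / p) := Real.mul_rpow (by norm_num) hpos.le
      _ ≤ 6 ^ (1 : ℝ) * nLog n ^ (1 / p) := by
          refine mul_le_mul_of_nonneg_right ?_ hb.le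
          exact Real.rpow_le_rpow_of_exponent_le (by norm_num) ((div_le_one hp0).2 (by linarith))
      _ = _ := by rw [Real.rpow_one]
  have h7 : |X (n + L n) - X n| ≤ η * (6 * nLog n ^ (1 / p)) + η * nLog n ^ (1 / p) := by
    refine (abs_sub _ _).trans (add_le_add ?_ (hN n hnN))
    exact (hN _ (by omega)).trans (mul_le_mul_of_nonneg_left h6 hηpos.le)
  have h8 := mul_le_mul_of_nonneg_left (hcL n) hδ.le
  have h9 : 0 < η * nLog n ^ (1 / p) := by positivity
  have h10 : δ * (c * nLog n ^ (1 / p)) = 8 * (η * nLog n ^ (1 / p)) := by rw [hη]; ring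
  linarith

theorem mainTheorem11 (p : ℝ) (hp : 2 < p) {Ω : Type*} [MeasurableSpace Ω] (P : Measure Ω)
    [IsProbabilityMeasure P] (ξ : Ω → ℝ) (ε : ℕ → Ω → ℝ × ℝ)
    (hW : IsChainInput P (p - 1) ξ ε) :
    -- the meeting-time condition fails
    (∀ ξ' : Ω → ℝ, Measurable ξ' → P.map ξ' = nuLaw (p - 1) →
      IndepFun ξ' (fun ω => (ξ ω, fun k => ε k ω)) P →
      ¬ TailSumFinite P p (meetingTime (chain (p - 1) ξ ε) (chain (p - 1) ξ' ε))) ∧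
    -- no Gaussian approximation with error `o((n log n)^(1/p))`
    (∀ f f' : ℝ → ℝ,
      (∀ x ∈ Icc (0 : ℝ) 1, HasDerivWithinAt f (f' x) (Icc (0 : ℝ) 1) x) →
      ContinuousOn f' (Icc (0 : ℝ) 1) →
      (∀ x ∈ Icc (0 : ℝ) 1, 0 < f' x) →
      ∀ g : ℤ → Ω → ℝ, IsStationaryGaussian P g →
      ∀ᵐ ω ∂P, (0 : EReal) < limsup (fun n : ℕ =>
        ((((n : ℝ) * Real.log n) ^ (-(1 / p)) *
          |∑ k ∈ Finset.Icc 1 n, f (chain (p - 1) ξ ε k ω ^ (p - 1)) - n * (∫ t in (0 : ℝ)..1, f t)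
            - ∑ k ∈ Finset.Icc 1 n, g (k : ℤ) ω| : ℝ) : EReal)) atTop) := by
  refine ⟨fun ξ' hξ' hlaw hind => not_tailSumFinite_meetingTime (by linarith) hW hξ' hlaw hind, ?_⟩
  intro f f' hf _ hpos g hg
  have ha : 0 < p - 1 := by linarith
  have hq : 0 < 1 / p := by positivity
  have hint := left_lt_integral_of_deriv_pos hf hpos
  set I := ∫ t in (0 : ℝ)..1, f t with hI
  -- a third of the gap: one for the error in `f`, one for the Gaussian block, one is left
  set δ : ℝ := (I - f 0) / 3 with hδ
  have hδpos : 0 < δ := by rw [hδ]; linarith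
  have hb : ∀ n, 0 < nLog n ^ (1 / p) := fun n =>
    Real.rpow_pos_of_pos (zero_lt_one.trans_le (one_le_nLog n)) _
  set L : ℕ → ℕ → ℕ := fun m n => ⌈1 / ((m : ℝ) + 1) * nLog n ^ (1 / p)⌉₊ with hL
  have hvl : ∀ n, (nLog n)⁻¹ ^ (p - 1 + 1)⁻¹ = (nLog n ^ (1 / p))⁻¹ := fun n => by
    rw [sub_add_cancel, Real.inv_rpow (zero_le_one.trans (one_le_nLog n)), one_div]
  have hcL : ∀ m n : ℕ, 1 / ((m : ℝ) + 1) * nLog n ^ (1 / p) ≤ L m n := fun m n => Nat.le_ceil _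
  have hceil : ∀ m n : ℕ, (L m n : ℝ) - 1 ≤ 1 / ((m : ℝ) + 1) * nLog n ^ (1 / p) := fun m n => by
    have h0 : 0 ≤ 1 / ((m : ℝ) + 1) * nLog n ^ (1 / p) := mul_nonneg (by positivity) (hb n).le
    linarith [Nat.ceil_lt_add_one h0]
  have hold := ae_exists_frequently_hold ha hW (v := fun n => (nLog n)⁻¹)
    (fun n => ⟨inv_nonneg.2 (zero_le_one.trans (one_le_nLog n)), inv_le_one_of_one_le₀
        (one_le_nLog n)⟩)
    (fun m n hmn => inv_anti₀ (zero_lt_one.trans_le (one_le_nLog m)) (nLog_mono hmn))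
    not_summable_inv_nLog (L := L) fun m n => by
      rw [hvl, ← div_eq_mul_inv, div_le_iff₀ (hb n)]
      exact hceil m n
  have hgauss : ∀ᵐ ω ∂P, ∀ m : ℕ, ∀ᶠ n : ℕ in atTop,
      |∑ i ∈ Finset.Ioc n (n + L m n), g (i : ℤ) ω| ≤ δ * L m n := by
    refine ae_all_iff.2 fun m => hg.ae_eventually_abs_block_le
      (c := 1 / ((m : ℝ) + 1)) (q := 1 / p) (by positivity) hq hδpos fun n => ?_
    refine le_trans ?_ (hcL m n)
    refine mul_le_mul_of_nonneg_left ?_ (by positivity)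
    exact Real.rpow_le_rpow (by positivity) (natCast_le_nLog n) hq.le
  -- near `0` the function is below its mean by almost the full gap
  have hnear : ∀ᶠ n : ℕ in atTop, ∀ w ∈ Icc 0 (nLog n ^ (1 / p))⁻¹, f (w ^ (p - 1)) ≤ f 0 + δ := by
    have hc : ContinuousWithinAt f (Icc 0 1) 0 := (hf 0 (by simp)).continuousWithinAt
    have h1 : ∀ᶠ x in 𝓝[Icc 0 1] (0 : ℝ), f x < f 0 + δ :=
      hc.eventually_lt tendsto_const_nhds (by linarith)
    obtain ⟨r, hr, hball⟩ := Metric.mem_nhdsWithin_iff.1 h1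
    have h2 : Tendsto (fun n : ℕ => (nLog n ^ (1 / p))⁻¹) atTop (𝓝 0) := by
      refine tendsto_inv_atTop_zero.comp (tendsto_atTop_mono (fun n => ?_)
        ((tendsto_rpow_atTop hq).comp tendsto_natCast_atTop_atTop))
      exact Real.rpow_le_rpow (by positivity) (natCast_le_nLog n) hq.le
    filter_upwards [h2.eventually_lt_const hr] with n hn w hw
    have hw1 : w ≤ 1 := hw.2.trans (inv_le_one_of_one_le₀ (Real.one_le_rpow (one_le_nLog n) hq.le))
    have hw2 : w ^ (p - 1) ≤ w := by
      have := Real.rpow_le_rpow_of_exponent_ge' hw.1 hw1 zero_le_one (by linarith : (1 : ℝ) ≤ p - 1)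
      rwa [Real.rpow_one] at this
    have hw0 : 0 ≤ w ^ (p - 1) := Real.rpow_nonneg hw.1 _
    refine le_of_lt (hball ⟨?_, hw0, hw2.trans hw1⟩)
    rw [Metric.mem_ball, Real.dist_eq, sub_zero, abs_of_nonneg hw0]
    exact (hw2.trans hw.2).trans_lt hn
  filter_upwards [hold, hgauss] with ω ⟨m, hm⟩ hω
  refine zero_lt_limsup_of_frequently_block (c := 1 / ((m : ℝ) + 1)) (δ := δ) (L := L m)
    (X := fun n => ∑ k ∈ Finset.Icc 1 n, f (chain (p - 1) ξ ε k ω ^ (p - 1)) - n * I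
      - ∑ k ∈ Finset.Icc 1 n, g (k : ℤ) ω) hp.le (by positivity) hδpos (hcL m) (fun n => ?_) ?_
  · have h1 : 1 / ((m : ℝ) + 1) * nLog n ^ (1 / p) ≤ 1 * nLog n ^ (1 / p) := by
      refine mul_le_mul_of_nonneg_right ?_ (hb n).le
      rw [div_le_one (by positivity)]
      linarith [Nat.cast_nonneg (α := ℝ) m]
    linarith [hceil m n]
  · refine (hm.and_eventually ((hω m).and hnear)).mono ?_
    rintro n ⟨⟨w, hw, hhold⟩, hG, hf0⟩
    rw [hvl] at hw
    have hfw := hf0 w hw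
    have hblock : ∀ h : ℕ → ℝ, ∑ k ∈ Finset.Icc 1 (n + L m n), h k =
        ∑ k ∈ Finset.Icc 1 n, h k + ∑ k ∈ Finset.Ioc n (n + L m n), h k := fun h => by
      have hIcc : ∀ N, Finset.Icc 1 N = Finset.Ioc 0 N := fun N => by
        ext i
        rw [Finset.mem_Icc, Finset.mem_Ioc, Nat.succ_le_iff]
      rw [hIcc, hIcc]
      exact (Finset.sum_Ioc_consecutive h n.zero_le (by omega)).symm
    have hconst : ∑ k ∈ Finset.Ioc n (n + L m n), f (chain (p - 1) ξ ε k ω ^ (p - 1)) =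
        L m n * f (w ^ (p - 1)) := by
      rw [Finset.sum_congr rfl fun i hi => by rw [hhold i hi]]
      simp
    have hdiff : (∑ k ∈ Finset.Icc 1 (n + L m n), f (chain (p - 1) ξ ε k ω ^ (p - 1))
        - ((n + L m n : ℕ) : ℝ) * I - ∑ k ∈ Finset.Icc 1 (n + L m n), g (k : ℤ) ω)
        - (∑ k ∈ Finset.Icc 1 n, f (chain (p - 1) ξ ε k ω ^ (p - 1)) - n * I
        - ∑ k ∈ Finset.Icc 1 n, g (k : ℤ) ω) =
        -(L m n * (I - f (w ^ (p - 1))) + ∑ k ∈ Finset.Ioc n (n + L m n), g (k : ℤ) ω) := by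
      rw [hblock, hblock (fun k => g (k : ℤ) ω), hconst]
      push_cast
      ring
    have hgap : 2 * δ ≤ I - f (w ^ (p - 1)) := by
      have : I - f 0 = 3 * δ := by rw [hδ]; ring
      linarith
    have h1 := mul_le_mul_of_nonneg_left hgap (Nat.cast_nonneg (α := ℝ) (L m n))
    have h2 := (abs_le.1 hG).1
    rw [hdiff, abs_neg]
    refine le_trans ?_ (le_abs_self _)
    linarith
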